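/- **Setting.** Let $M$ be a smooth manifold with a magnetic system $(g,\sigma)$: a smooth Riemannian metric $g$ and a smooth closed $2$-form $\sigma$. Its Lorentz force $Y$ is given by $g_x(Y_x(v),w)=\sigma_x(v,w)$. Let $\nabla$ be the Levi-Civita connection, $R(X,Y)Z=\nabla_X\nabla_YZ-\nabla_Y\nabla_XZ-\nabla_{[X,Y]}Z$, and, for a unit vector $v\in T_xM$, let $P_v$ and $P_{v^\perp}$ be the orthogonal projections of $T_xM$ onto $\mathbb{R}v$ and $v^\perp$. For $s>0$ and $w\perp v$, the $s$-magnetic curvature operator is $$(M^{g,\sigma}_s)_{(x,v)}(w)=s^2R_x(w,v)v-s(\nabla_wY)_x(v)+\tfrac s2P_{v^\perp}\big((\nabla_vY)_x(w)\big)-\tfrac34Y_x\big(P_v(Y_x(w))\big)-\tfrac14P_{v^\perp}\big(Y_x^2(w)\big).$$ Let $N$ be a submanifold of $M$ (embedded or, more generally, immersed) with the restricted magnetic system. The superscripts $M,N$ indicate the manifold to which an object belongs, and $z^\top$, $z^\perp$ are the components of $z\in T_xM=T_xN\oplus[T_xN]^\perp$. Let $\mathrm{II}(X,Z)=(\nabla^M_XZ)^\perp$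 be the second fundamental form, $S_\xi$ the shape operator, $g(S_\xi(X),Z)=g(\mathrm{II}(X,Z),\xi)$, and $\nabla^\perp_X\xi=(\nabla^M_X\xi)^\perp$ the normal connection. For $x\in N$, $v,w\in T_xN$ and $\xi\in[T_xN]^\perp$ put $Y^\perp_x(w)=Y^M_x(w)^\perp$ and $$(\mathrm{II}^\sigma_s)_{(x,v)}(w)=s^2\,\mathrm{II}_x(v,w)-sY^\perp_x(w),\qquad (S^\sigma_s)_{(x,v)}(\xi)=s^2S_\xi(v)+sY^M_x(\xi)^\top .$$ For vector fields $X,V,W$ tangent to $N$ put $$(\nabla^\perp_X\mathrm{II})(V,W)=\nabla^\perp_X(\mathrm{II}(V,W))-\mathrm{II}(\nabla^N_XV,W)-\mathrm{II}(V,\nabla^N_XW),\qquad (\nabla^\perp_XY^\perp)(W)=\nabla^\perp_X(Y^\perp(W))-Y^\perp(\nabla^N_XW),$$ and for $z,v,w\in T_xN$ put $(\nabla^\perp_z\mathrm{II}^\sigma_s)_{(x,v)}(w)=s^2(\nabla^\perp_z\mathrm{II})_x(v,w)-s(\nabla^\perp_zY^\perp)_x(w)$. **Theorem.** For all $x\in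 N$, all unit vectors $v\in T_xN$, all $w\in T_xN\cap v^\perp$ and all $s>0$: (i) $$\begin{aligned}(M^{g,\sigma}_s)^M_{(x,v)}(w)^\top={}&(M^{g,\sigma}_s)^N_{(x,v)}(w)-S_{(\mathrm{II}^\sigma_s)_{(x,v)}(v)}(w)+(S^\sigma_s)_{(x,v)}(\mathrm{II}_x(v,w))\\&-\tfrac12P_{v^\perp}\Big(sS_{Y^\perp_x(w)}(v)+sY^M_x(\mathrm{II}_x(v,w))^\top+\tfrac12Y^M_x(Y^\perp_x(w))^\top\Big);\end{aligned}$$ (ii) $$\begin{aligned}(M^{g,\sigma}_s)^M_{(x,v)}(w)^\perp={}&(\nabla^\perp_w\mathrm{II}^\sigma_s)_{(x,v)}(v)-(\nabla^\perp_v\mathrm{II}^\sigma_s)_{(x,v)}(w)-\tfrac s2(\nabla^\perp_vY^\perp)_x(w)\\&-s\,\mathrm{II}_x(w,Y^N_x(v))+\tfrac s2Y^M_x(\mathrm{II}_x(v,w))^\perp+\tfrac s2\mathrm{II}_x(v,Y^N_x(w))\\&-\tfrac34Y^\perp_x\big(P_v(Y^N_x(w))\big)-\tfrac14Y^\perp_x(Y^N_x(w))-\tfrac14Y^M_x(Y^\perp_x(w))^\perp.\end{aligned}$$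 -/

import Mathlib

open scoped Manifold ContDiff Bundle

noncomputable section

namespace MagneticGeometry

/-- The vector `u` of `V` which represents the linear functional `α` with respect to the bilinear
form `b`, that is, `b u w = α w` for all `w`. It exists and is unique when `V` is finite-dimensional
and `b` is positive definite. -/
def rieszVec {V : Type*} [Nonempty V] (b : V → V → ℝ) (α : V → ℝ) : V :=
  Classical.epsilon fun u : V => ∀ w : V, b u w = α w

section Manifold

variable {E : Type*} [NormedAddCommGroup E] [NormedSpace ℝ E]
  {M : Type*} [TopologicalSpace M] [ChartedSpace E M] [IsManifold 𝓘(ℝ, E) ∞ M]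

/-- Fields of covariant 2-tensors on a manifold `M` modelled on `E`. -/
abbrev TwoTensor (E : Type*) [NormedAddCommGroup E] [NormedSpace ℝ E]
    (M : Type*) [TopologicalSpace M] [ChartedSpace E M] : Type _ :=
  ∀ x : M, TangentSpace 𝓘(ℝ, E) x →L[ℝ] TangentSpace 𝓘(ℝ, E) x →L[ℝ] ℝ

/-- The vector field, defined and smooth near `x`, which has value `v` at `x` and constant
components in the preferred chart of `M` at `x`. -/
def coordField {x : M} (v : TangentSpace 𝓘(ℝ, E) x) :
    ∀ y : M, TangentSpace 𝓘(ℝ, E) y :=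
  FiberBundle.extend E v

/-- The value on `X, Y, Z` of the exterior derivative of a 2-form `σ`. -/
def extDerivTwo (σ : TwoTensor E M) (X Y Z : ∀ y : M, TangentSpace 𝓘(ℝ, E) y) (x : M) : ℝ :=
  mvfderiv 𝓘(ℝ, E) (fun y => σ y (Y y) (Z y)) x (X x)
    - mvfderiv 𝓘(ℝ, E) (fun y => σ y (X y) (Z y)) x (Y x)
    + mvfderiv 𝓘(ℝ, E) (fun y => σ y (X y) (Y y)) x (Z x)
    - σ x (VectorField.mlieBracket 𝓘(ℝ, E) X Y x) (Z x)
    + σ x (VectorField.mlieBracket 𝓘(ℝ, E) X Z x) (Y x)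
    - σ x (VectorField.mlieBracket 𝓘(ℝ, E) Y Z x) (X x)

variable (E M) in
/-- A magnetic system on `M`: a smooth Riemannian metric and a smooth closed 2-form. -/
structure MagneticSystem where
  /-- The Riemannian metric. -/
  metric : Bundle.ContMDiffRiemannianMetric 𝓘(ℝ, E) ∞ E
    (fun x : M => TangentSpace 𝓘(ℝ, E) x)
  /-- The magnetic form. -/
  form : TwoTensor E M
  form_self : ∀ (x : M) (v : TangentSpace 𝓘(ℝ, E) x), form x v v = 0
  form_smooth : ContMDiff 𝓘(ℝ, E) (𝓘(ℝ, E).prod 𝓘(ℝ, E →L[ℝ] E →L[ℝ] ℝ)) ∞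
    (fun x : M => Bundle.TotalSpace.mk' (E →L[ℝ] E →L[ℝ] ℝ)
      (E := fun x : M => TangentSpace 𝓘(ℝ, E) x →L[ℝ] TangentSpace 𝓘(ℝ, E) x →L[ℝ] ℝ) x (form x))
  form_closed : ∀ (x : M) (X Y Z : ∀ y : M, TangentSpace 𝓘(ℝ, E) y),
    ContMDiffAt 𝓘(ℝ, E) 𝓘(ℝ, E).tangent ∞ (fun y => (⟨y, X y⟩ : TangentBundle 𝓘(ℝ, E) M)) x →
    ContMDiffAt 𝓘(ℝ, E) 𝓘(ℝ, E).tangent ∞ (fun y => (⟨y, Y y⟩ : TangentBundle 𝓘(ℝ, E) M)) x →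
    ContMDiffAt 𝓘(ℝ, E) 𝓘(ℝ, E).tangent ∞ (fun y => (⟨y, Z y⟩ : TangentBundle 𝓘(ℝ, E) M)) x →
    extDerivTwo form X Y Z x = 0

/-- The metric of a magnetic system, as a tensor field. -/
def MagneticSystem.g (B : MagneticSystem E M) : TwoTensor E M := B.metric.inner

/-! ### The Levi-Civita connection

In the definitions below, `g` is the tensor field of a smooth Riemannian metric. -/

/-- The Christoffel symbols of `g` at `x` in the preferred chart at `x`, as a bilinear map:
`g (Γ (u, v), w) = (u g(V, W) + v g(U, W) - w g(U, V)) / 2`, where the fields `U, V, W` have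
constant components in this chart. -/
def christoffel (g : TwoTensor E M) (x : M) (u v : TangentSpace 𝓘(ℝ, E) x) :
    TangentSpace 𝓘(ℝ, E) x :=
  rieszVec (fun a b => g x a b) fun w =>
    (mvfderiv 𝓘(ℝ, E) (fun y => g y (coordField v y) (coordField w y)) x u
      + mvfderiv 𝓘(ℝ, E) (fun y => g y (coordField u y) (coordField w y)) x v
      - mvfderiv 𝓘(ℝ, E) (fun y => g y (coordField u y) (coordField v y)) x w) / 2

/-- The covariant derivative `∇_v ξ` at `x` of a vector field `ξ` along a map `f : B → M`, with
respect to the Levi-Civita connection of the metric `g` on `M`: the derivative along `v` of the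
components of `ξ` in the preferred chart of `M` at `f x`, plus the Christoffel term
`Γ (df v, ξ)`. -/
def covAlong {F : Type*} [NormedAddCommGroup F] [NormedSpace ℝ F]
    {B : Type*} [TopologicalSpace B] [ChartedSpace F B]
    (g : TwoTensor E M) (f : B → M) (ξ : ∀ b : B, TangentSpace 𝓘(ℝ, E) (f b)) (x : B)
    (v : TangentSpace 𝓘(ℝ, F) x) : TangentSpace 𝓘(ℝ, E) (f x) :=
  (trivializationAt E (TangentSpace 𝓘(ℝ, E) : M → Type _) (f x)).symm (f x)
      (mvfderiv 𝓘(ℝ, F) (fun b : B =>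
        (trivializationAt E (TangentSpace 𝓘(ℝ, E) : M → Type _) (f x)
          (⟨f b, ξ b⟩ : TangentBundle 𝓘(ℝ, E) M)).2) x v)
    + christoffel g (f x) (mfderiv 𝓘(ℝ, F) 𝓘(ℝ, E) f x v) (ξ x)

/-- The Levi-Civita connection: `∇_v X` at `x`, for a vector field `X` on `M`. -/
def leviCivita (g : TwoTensor E M) (X : ∀ y : M, TangentSpace 𝓘(ℝ, E) y) (x : M)
    (v : TangentSpace 𝓘(ℝ, E) x) : TangentSpace 𝓘(ℝ, E) x :=
  covAlong g (fun y : M => y) X x v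

/-- The curvature tensor `R(u, v)w = ∇_U ∇_V W - ∇_V ∇_U W - ∇_[U,V] W` at `x`. -/
def curvature (g : TwoTensor E M) (x : M) (u v w : TangentSpace 𝓘(ℝ, E) x) :
    TangentSpace 𝓘(ℝ, E) x :=
  leviCivita g (fun y => leviCivita g (coordField w) y (coordField v y)) x u
    - leviCivita g (fun y => leviCivita g (coordField w) y (coordField u y)) x v
    - leviCivita g (coordField w) x
        (VectorField.mlieBracket 𝓘(ℝ, E) (coordField u) (coordField v) x)

/-! ### The magnetic curvature operator of a metric `g` and a 2-form `σ` -/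

/-- The Lorentz force operator `Y`: `g (Y v, w) = σ (v, w)`. -/
def lorentz (g σ : TwoTensor E M) (x : M) (v : TangentSpace 𝓘(ℝ, E) x) :
    TangentSpace 𝓘(ℝ, E) x :=
  rieszVec (fun a b => g x a b) fun w => σ x v w

/-- The covariant derivative of the Lorentz force: `(∇_v Y)(w) = ∇_v (Y (W)) - Y (∇_v W)`. -/
def nablaLorentz (g σ : TwoTensor E M) (x : M) (v w : TangentSpace 𝓘(ℝ, E) x) :
    TangentSpace 𝓘(ℝ, E) x :=
  leviCivita g (fun y => lorentz g σ y (coordField w y)) x v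
    - lorentz g σ x (leviCivita g (coordField w) x v)

/-- The `g`-orthogonal projection of `z` onto the line spanned by `v`. -/
def projLine (g : TwoTensor E M) (x : M) (v z : TangentSpace 𝓘(ℝ, E) x) :
    TangentSpace 𝓘(ℝ, E) x :=
  (g x v z / g x v v) • v

/-- The `g`-orthogonal projection of `z` onto the hyperplane orthogonal to `v`. -/
def projHyper (g : TwoTensor E M) (x : M) (v z : TangentSpace 𝓘(ℝ, E) x) :
    TangentSpace 𝓘(ℝ, E) x :=
  z - projLine g x v z

/-- The operator `A` at `(x, v)`:
`A (w) = -(3/4) Y (P_v (Y w)) - (1/4) P_{v^⊥} (Y (Y w))`. -/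
def opA (g σ : TwoTensor E M) (x : M) (v w : TangentSpace 𝓘(ℝ, E) x) :
    TangentSpace 𝓘(ℝ, E) x :=
  -((3 / 4 : ℝ) • lorentz g σ x (projLine g x v (lorentz g σ x w)))
    - (1 / 4 : ℝ) • projHyper g x v (lorentz g σ x (lorentz g σ x w))

/-- The operator `R_s` at `(x, v)`:
`R_s (w) = s² R(w, v)v - s (∇_w Y)(v) + (s/2) P_{v^⊥} ((∇_v Y)(w))`. -/
def opR (g σ : TwoTensor E M) (s : ℝ) (x : M) (v w : TangentSpace 𝓘(ℝ, E) x) :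
    TangentSpace 𝓘(ℝ, E) x :=
  s ^ 2 • curvature g x w v v - s • nablaLorentz g σ x w v
    + (s / 2) • projHyper g x v (nablaLorentz g σ x v w)

/-- The `s`-magnetic curvature operator at `(x, v)`, evaluated at `w`. -/
def magCurv (g σ : TwoTensor E M) (s : ℝ) (x : M) (v w : TangentSpace 𝓘(ℝ, E) x) :
    TangentSpace 𝓘(ℝ, E) x :=
  opR g σ s x v w + opA g σ x v w

end Manifold

section Submanifold

/-! ### Submanifolds

`N` is a submanifold of `M` with inclusion `ι : N → M`. Vectors normal to `N` at `x` are elements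
of the tangent space of `M` at `ι x`. -/

variable {E : Type*} [NormedAddCommGroup E] [NormedSpace ℝ E]
  {M : Type*} [TopologicalSpace M] [ChartedSpace E M] [IsManifold 𝓘(ℝ, E) ∞ M]
  {F : Type*} [NormedAddCommGroup F] [NormedSpace ℝ F]
  {N : Type*} [TopologicalSpace N] [ChartedSpace F N] [IsManifold 𝓘(ℝ, F) ∞ N]

/-- The differential of `ι`. -/
def dmap (ι : N → M) (x : N) :
    TangentSpace 𝓘(ℝ, F) x →L[ℝ] TangentSpace 𝓘(ℝ, E) (ι x) :=
  mfderiv 𝓘(ℝ, F) 𝓘(ℝ, E) ι x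

/-- The pullback `ι^* τ`, that is, the restriction of `τ` to `N`. -/
def induced (ι : N → M) (τ : TwoTensor E M) : TwoTensor F N :=
  fun x => ((dmap ι x).precomp ℝ) ∘L (τ (ι x) ∘L dmap ι x)

/-- The tangential part of a vector of `M` at a point of `N`, as a tangent vector of `N`. -/
def tanPart (g : TwoTensor E M) (ι : N → M) (x : N) (z : TangentSpace 𝓘(ℝ, E) (ι x)) :
    TangentSpace 𝓘(ℝ, F) x :=
  rieszVec (fun a b => induced ι g x a b) fun w => g (ι x) z (dmap ι x w)

variable (F) in
/-- The normal part of a vector of `M` at a point of `N`, where `N` is modelled on `F`. -/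
def norPart (g : TwoTensor E M) (ι : N → M) (x : N) (z : TangentSpace 𝓘(ℝ, E) (ι x)) :
    TangentSpace 𝓘(ℝ, E) (ι x) :=
  z - dmap ι x (tanPart g ι x z : TangentSpace 𝓘(ℝ, F) x)

/-- The normal connection: `∇^⊥_z ξ` at `x`, for a normal field `ξ` along `N`. -/
def norConn (g : TwoTensor E M) (ι : N → M) (ξ : ∀ y : N, TangentSpace 𝓘(ℝ, E) (ι y)) (x : N)
    (z : TangentSpace 𝓘(ℝ, F) x) : TangentSpace 𝓘(ℝ, E) (ι x) :=
  norPart F g ι x (covAlong g ι ξ x z)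

/-- The second fundamental form: `II (v, w)` is the normal part of `∇^M_v W`, for any vector field
`W` tangent to `N` with value `w` at `x`. -/
def secondFF (g : TwoTensor E M) (ι : N → M) (x : N) (v w : TangentSpace 𝓘(ℝ, F) x) :
    TangentSpace 𝓘(ℝ, E) (ι x) :=
  norPart F g ι x (covAlong g ι (fun y => dmap ι y (coordField w y)) x v)

/-- The shape operator associated with the normal vector `ξ`: `g (S_ξ (v), w) = g (II (v, w), ξ)`
for all `w` tangent to `N`. -/
def shapeOp (g : TwoTensor E M) (ι : N → M) (x : N) (ξ : TangentSpace 𝓘(ℝ, E) (ι x))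
    (v : TangentSpace 𝓘(ℝ, F) x) : TangentSpace 𝓘(ℝ, F) x :=
  rieszVec (fun a b => induced ι g x a b) fun w => g (ι x) (secondFF g ι x v w) ξ

/-- The normal Lorentz force `Y^⊥ (v) = [Y^M (v)]^⊥`, for `v` tangent to `N`. -/
def norLorentz (g σ : TwoTensor E M) (ι : N → M) (x : N) (v : TangentSpace 𝓘(ℝ, F) x) :
    TangentSpace 𝓘(ℝ, E) (ι x) :=
  norPart F g ι x (lorentz g σ (ι x) (dmap ι x v))

/-- The `s`-magnetic second fundamental form at `(x, v)`: `s² II (v, w) - s Y^⊥ (w)`. -/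
def magSecondFF (g σ : TwoTensor E M) (ι : N → M) (s : ℝ) (x : N)
    (v w : TangentSpace 𝓘(ℝ, F) x) : TangentSpace 𝓘(ℝ, E) (ι x) :=
  s ^ 2 • secondFF g ι x v w - s • norLorentz g σ ι x w

/-- The `s`-magnetic shape operator at `(x, v)`: `s² S_ξ (v) + s [Y^M (ξ)]^⊤`. -/
def magShapeOp (g σ : TwoTensor E M) (ι : N → M) (s : ℝ) (x : N)
    (v : TangentSpace 𝓘(ℝ, F) x) (ξ : TangentSpace 𝓘(ℝ, E) (ι x)) : TangentSpace 𝓘(ℝ, F) x :=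
  s ^ 2 • shapeOp g ι x ξ v + s • tanPart g ι x (lorentz g σ (ι x) ξ)

/-- The normal covariant derivative of the second fundamental form:
`(∇^⊥_z II)(v, w) = ∇^⊥_z (II (V, W)) - II (∇^N_z V, w) - II (v, ∇^N_z W)`. -/
def norNablaSecondFF (g : TwoTensor E M) (ι : N → M) (x : N)
    (z v w : TangentSpace 𝓘(ℝ, F) x) : TangentSpace 𝓘(ℝ, E) (ι x) :=
  norConn g ι (fun y => secondFF g ι y (coordField v y) (coordField w y)) x z
    - secondFF g ι x (leviCivita (induced ι g) (coordField v) x z) w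
    - secondFF g ι x v (leviCivita (induced ι g) (coordField w) x z)

/-- The normal covariant derivative of the normal Lorentz force:
`(∇^⊥_z Y^⊥)(w) = ∇^⊥_z (Y^⊥ (W)) - Y^⊥ (∇^N_z W)`. -/
def norNablaLorentz (g σ : TwoTensor E M) (ι : N → M) (x : N)
    (z w : TangentSpace 𝓘(ℝ, F) x) : TangentSpace 𝓘(ℝ, E) (ι x) :=
  norConn g ι (fun y => norLorentz g σ ι y (coordField w y)) x z
    - norLorentz g σ ι x (leviCivita (induced ι g) (coordField w) x z)

/-- The normal covariant derivative of the `s`-magnetic second fundamental form at `(x, v)`: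
`(∇^⊥_z II_s)(w) = s² (∇^⊥_z II)(v, w) - s (∇^⊥_z Y^⊥)(w)`. -/
def norNablaMagSecondFF (g σ : TwoTensor E M) (ι : N → M) (s : ℝ) (x : N)
    (z v w : TangentSpace 𝓘(ℝ, F) x) : TangentSpace 𝓘(ℝ, E) (ι x) :=
  s ^ 2 • norNablaSecondFF g ι x z v w - s • norNablaLorentz g σ ι x z w

end Submanifold

end MagneticGeometry

end

/-! Both formulas are linear algebra on top of a few splittings of a derivative along `ι` into
tangent and normal parts. The Gauss formula says that the ambient derivative of a tangent field is
its intrinsic derivative plus `II`. Differentiating this once more and antisymmetrizing expresses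
the ambient curvature on tangent vectors (`gauss_codazzi`). Differentiating the splitting of `Y^M`,
on tangent vectors, into `Y^N + Y^⊥` expresses `∇Y` (`nabLor_immersion`). Both identities still
contain ambient derivatives of normal fields: the tangential part of such a derivative is minus a
shape operator (`weingarten`, `tan_cov_normal`), and its normal part is the normal connection. Since
`v` is tangent to `N`, the projections onto `ℝv` and `v^⊥` are compatible with the splitting, and
collecting terms gives `tan_magModel` and `nor_magModel`.

These computations take place in the model spaces `E` and `F`, for a coordinate expression `f` of
`ι`. The passage from the manifolds is delicate because `covAlong` uses the preferred chart at the
moving point, so that an iterated covariant derivative changes chart from point to point.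
`comps_covAlong` shows that every fixed chart computes the same vector, by the transformation law
`christ_change` of the Christoffel symbols. That law is `pull_christ` applied to a transition map;
the same lemma, applied to `f`, identifies the tangential part in the Gauss formula. -/

noncomputable section

namespace MagneticGeometry

open Filter Topology

set_option maxSynthPendingDepth 3

/-! ### Linear algebra of positive definite forms. -/

section Inner

variable {V : Type*} [NormedAddCommGroup V] [NormedSpace ℝ V]

/-- A symmetric positive definite bilinear form. -/
def IsInner (b : V →L[ℝ] V →L[ℝ] ℝ) : Prop :=
  (∀ u v, b u v = b v u) ∧ ∀ u, u ≠ 0 → 0 < b u u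

theorem IsInner.eq_of_forall {b : V →L[ℝ] V →L[ℝ] ℝ} (hb : IsInner b) {u v : V}
    (h : ∀ w, b u w = b v w) : u = v := by
  by_contra hne
  have := hb.2 (u - v) (sub_ne_zero.2 hne)
  rw [map_sub (b (u - v)), map_sub b, sub_apply, sub_apply, h, h, sub_self, sub_self, sub_self]
    at this
  exact this.false

/-- Definiteness makes `b` injective into the dual space, which has the same dimension.
Invertibility is what makes `ContinuousLinearMap.inverse` a true inverse of `b`, and smooth near
`b`. -/
theorem IsInner.isInvertible [FiniteDimensional ℝ V] {b : V →L[ℝ] V →L[ℝ] ℝ} (hb : IsInner b) :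
    b.IsInvertible := by
  have hinj : Function.Injective (b : V →ₗ[ℝ] V →L[ℝ] ℝ) := fun u v h =>
    hb.eq_of_forall fun w => by
      have h' : b u = b v := h
      rw [h']
  have hrank : Module.finrank ℝ V = Module.finrank ℝ (V →L[ℝ] ℝ) := by
    rw [← (LinearMap.toContinuousLinearMap (𝕜 := ℝ) (E := V) (F' := ℝ)).finrank_eq]
    exact (Subspace.dual_finrank_eq (K := ℝ) (V := V)).symm
  refine ⟨(LinearEquiv.ofInjectiveOfFinrankEq (b : V →ₗ[ℝ] V →L[ℝ] ℝ) hinj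
    hrank).toContinuousLinearEquiv, ?_⟩
  ext u w
  rfl

theorem IsInner.apply_inverse [FiniteDimensional ℝ V] {b : V →L[ℝ] V →L[ℝ] ℝ} (hb : IsInner b)
    (α : V →L[ℝ] ℝ) : b (b.inverse α) = α := by
  obtain ⟨e, he⟩ := hb.isInvertible
  rw [← he, ContinuousLinearMap.inverse_equiv]
  simp

theorem IsInner.inverse_eq [FiniteDimensional ℝ V] {b : V →L[ℝ] V →L[ℝ] ℝ} (hb : IsInner b)
    {α : V →L[ℝ] ℝ} {u : V} (h : ∀ w, b u w = α w) : b.inverse α = u :=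
  hb.eq_of_forall fun w => by rw [hb.apply_inverse, h]

end Inner

/-! ### Levi-Civita calculus on a vector space. -/

section Model

variable {E : Type*} [NormedAddCommGroup E] [NormedSpace ℝ E]
  {F : Type*} [NormedAddCommGroup F] [NormedSpace ℝ F]

/-- The Koszul combination of the derivative of a metric. -/
def koszul (A : E →L[ℝ] E →L[ℝ] E →L[ℝ] ℝ) : E →L[ℝ] E →L[ℝ] E →L[ℝ] ℝ :=
  (1 / 2 : ℝ) • (A + A.flip
    - ((ContinuousLinearMap.flipₗᵢ ℝ E E ℝ).toContinuousLinearEquiv :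
        (E →L[ℝ] E →L[ℝ] ℝ) →L[ℝ] (E →L[ℝ] E →L[ℝ] ℝ)) ∘L A.flip)

theorem koszul_apply (A : E →L[ℝ] E →L[ℝ] E →L[ℝ] ℝ) (a b c : E) :
    koszul A a b c = (A a b c + A b a c - A c a b) / 2 := by
  simp [koszul]
  ring

/-- The Christoffel symbols of a metric on a vector space. -/
def christ (G : E → E →L[ℝ] E →L[ℝ] ℝ) (p : E) : E →L[ℝ] E →L[ℝ] E :=
  (ContinuousLinearMap.compL ℝ E (E →L[ℝ] ℝ) E (G p).inverse) ∘L koszul (fderiv ℝ G p)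

theorem christ_apply (G : E → E →L[ℝ] E →L[ℝ] ℝ) (p a b : E) :
    christ G p a b = (G p).inverse (koszul (fderiv ℝ G p) a b) := rfl

/-- The pullback of a tensor by a map between vector spaces. -/
def pull (G : E → E →L[ℝ] E →L[ℝ] ℝ) (f : F → E) (z : F) : F →L[ℝ] F →L[ℝ] ℝ :=
  ((fderiv ℝ f z).precomp ℝ) ∘L (G (f z) ∘L fderiv ℝ f z)

@[simp] theorem pull_apply (G : E → E →L[ℝ] E →L[ℝ] ℝ) (f : F → E) (z a b : F) :
    pull G f z a b = G (f z) (fderiv ℝ f z a) (fderiv ℝ f z b) := rfl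

/-- The tangential projection along an immersion. -/
def tanOp (G : E → E →L[ℝ] E →L[ℝ] ℝ) (f : F → E) (z : F) : E →L[ℝ] F :=
  (pull G f z).inverse ∘L (((fderiv ℝ f z).precomp ℝ) ∘L G (f z))

/-- The normal projection along an immersion. -/
def norOp (G : E → E →L[ℝ] E →L[ℝ] ℝ) (f : F → E) (z : F) : E →L[ℝ] E :=
  ContinuousLinearMap.id ℝ E - fderiv ℝ f z ∘L tanOp G f z

/-- The covariant derivative of a field along a map. -/
def cov (G : E → E →L[ℝ] E →L[ℝ] ℝ) (f : F → E) (ξ : F → E) (z u : F) : E :=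
  fderiv ℝ ξ z u + christ G (f z) (fderiv ℝ f z u) (ξ z)

/-- The second fundamental form of an immersion. -/
def secFF (G : E → E →L[ℝ] E →L[ℝ] ℝ) (f : F → E) (z u w : F) : E :=
  norOp G f z (fderiv ℝ (fderiv ℝ f) z u w
    + christ G (f z) (fderiv ℝ f z u) (fderiv ℝ f z w))

/-- The curvature of a metric. -/
def riem (G : E → E →L[ℝ] E →L[ℝ] ℝ) (p a b c : E) : E :=
  fderiv ℝ (fun y => christ G y b c) p a + christ G p a (christ G p b c)
    - (fderiv ℝ (fun y => christ G y a c) p b + christ G p b (christ G p a c))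

/-- The Lorentz force of a 2-form. -/
def lor (G σ : E → E →L[ℝ] E →L[ℝ] ℝ) (p : E) : E →L[ℝ] E := (G p).inverse ∘L σ p

/-- The covariant derivative of the Lorentz force. -/
def nabLor (G σ : E → E →L[ℝ] E →L[ℝ] ℝ) (p a b : E) : E :=
  fderiv ℝ (fun y => lor G σ y b) p a + christ G p a (lor G σ p b) - lor G σ p (christ G p a b)

theorem fderiv_smooth {f : F → E} {z : F} (hf : ContDiffAt ℝ ∞ f z) :
    ContDiffAt ℝ ∞ (fderiv ℝ f) z := hf.fderiv_right (by norm_cast)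

set_option synthInstance.maxHeartbeats 200000 in
theorem christ_smooth [FiniteDimensional ℝ E] {G : E → E →L[ℝ] E →L[ℝ] ℝ} {p : E} (hG : ContDiffAt ℝ ∞ G p)
    (hi : IsInner (G p)) : ContDiffAt ℝ ∞ (christ G) p := by
  have := FiniteDimensional.complete ℝ E
  have h1 : ContDiffAt ℝ ∞ (fun y => (G y).inverse) p :=
    (hi.isInvertible.contDiffAt_map_inverse).comp p hG
  have h2 := fderiv_smooth hG
  have h3 : ContDiffAt ℝ ∞ (fun y => koszul (fderiv ℝ G y)) p := by
    unfold koszul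
    have h4 : ContDiffAt ℝ ∞ (fun y => (fderiv ℝ G y).flip) p :=
      (ContinuousLinearMap.flipₗᵢ ℝ E E (E →L[ℝ] ℝ)).contDiff.contDiffAt.comp p h2
    exact ((h2.add h4).sub (contDiffAt_const.clm_comp h4)).const_smul _
  have h5 : ContDiffAt ℝ ∞ (fun y => ContinuousLinearMap.compL ℝ E (E →L[ℝ] ℝ) E (G y).inverse) p :=
    (ContinuousLinearMap.contDiff _).contDiffAt.comp p h1
  exact h5.clm_comp h3

theorem lor_smooth [FiniteDimensional ℝ E] {G σ : E → E →L[ℝ] E →L[ℝ] ℝ} {p : E} (hG : ContDiffAt ℝ ∞ G p)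
    (hi : IsInner (G p)) (hσ : ContDiffAt ℝ ∞ σ p) : ContDiffAt ℝ ∞ (lor G σ) p := by
  have := FiniteDimensional.complete ℝ E
  exact ((hi.isInvertible.contDiffAt_map_inverse).comp p hG).clm_comp hσ

theorem precomp_smooth {f : F → E} {z : F} (hf : ContDiffAt ℝ ∞ f z) :
    ContDiffAt ℝ ∞ (fun y => ((fderiv ℝ f y).precomp ℝ : (E →L[ℝ] ℝ) →L[ℝ] (F →L[ℝ] ℝ))) z := by
  exact ((ContinuousLinearMap.compL ℝ F E ℝ).flip.contDiff).contDiffAt.comp z (fderiv_smooth hf)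

theorem pull_smooth {G : E → E →L[ℝ] E →L[ℝ] ℝ} {f : F → E} {z : F}
    (hG : ContDiffAt ℝ ∞ G (f z)) (hf : ContDiffAt ℝ ∞ f z) : ContDiffAt ℝ ∞ (pull G f) z :=
  (precomp_smooth hf).clm_comp ((hG.comp z hf).clm_comp (fderiv_smooth hf))

theorem pull_isInner {G : E → E →L[ℝ] E →L[ℝ] ℝ} {f : F → E} {z : F}
    (hi : IsInner (G (f z))) (hf : Function.Injective (fderiv ℝ f z)) : IsInner (pull G f z) :=
  ⟨fun _ _ => hi.1 _ _, fun _ hu => hi.2 _ fun h => hu (hf (h.trans (map_zero (fderiv ℝ f z)).symm))⟩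

theorem tanOp_smooth [FiniteDimensional ℝ F] {G : E → E →L[ℝ] E →L[ℝ] ℝ} {f : F → E} {z : F}
    (hG : ContDiffAt ℝ ∞ G (f z)) (hi : IsInner (pull G f z)) (hf : ContDiffAt ℝ ∞ f z) :
    ContDiffAt ℝ ∞ (tanOp G f) z := by
  have := FiniteDimensional.complete ℝ F
  have h1 : ContDiffAt ℝ ∞ (fun y => (pull G f y).inverse) z :=
    (hi.isInvertible.contDiffAt_map_inverse).comp z (pull_smooth hG hf)
  exact h1.clm_comp ((precomp_smooth hf).clm_comp (hG.comp z hf))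

theorem norOp_smooth [FiniteDimensional ℝ F] {G : E → E →L[ℝ] E →L[ℝ] ℝ} {f : F → E} {z : F}
    (hG : ContDiffAt ℝ ∞ G (f z)) (hi : IsInner (pull G f z)) (hf : ContDiffAt ℝ ∞ f z) :
    ContDiffAt ℝ ∞ (norOp G f) z :=
  contDiffAt_const.sub ((fderiv_smooth hf).clm_comp (tanOp_smooth hG hi hf))

/-- The derivative of a bilinear pairing of fields along a map. -/
theorem fderiv_pairing {G : E → E →L[ℝ] E →L[ℝ] ℝ} {f ξ η : F → E} {z : F}
    (hG : DifferentiableAt ℝ G (f z)) (hf : DifferentiableAt ℝ f z)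
    (hξ : DifferentiableAt ℝ ξ z) (hη : DifferentiableAt ℝ η z) (u : F) :
    fderiv ℝ (fun y => G (f y) (ξ y) (η y)) z u
      = fderiv ℝ G (f z) (fderiv ℝ f z u) (ξ z) (η z)
        + G (f z) (fderiv ℝ ξ z u) (η z) + G (f z) (ξ z) (fderiv ℝ η z u) := by
  have h1 := (((hG.hasFDerivAt.comp z hf.hasFDerivAt).clm_apply hξ.hasFDerivAt).clm_apply
    hη.hasFDerivAt).fderiv
  have h2 : fderiv ℝ (fun y => G (f y) (ξ y) (η y)) z
    = fderiv ℝ (fun y => ((G ∘ f) y) (ξ y) (η y)) z := rfl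
  rw [h2, h1]
  simp
  ring

theorem fderiv_pull {G : E → E →L[ℝ] E →L[ℝ] ℝ} {f : F → E} {z : F}
    (hG : ContDiffAt ℝ ∞ G (f z)) (hf : ContDiffAt ℝ ∞ f z) (a b c : F) :
    fderiv ℝ (pull G f) z a b c
      = fderiv ℝ G (f z) (fderiv ℝ f z a) (fderiv ℝ f z b) (fderiv ℝ f z c)
        + G (f z) (fderiv ℝ (fderiv ℝ f) z a b) (fderiv ℝ f z c)
        + G (f z) (fderiv ℝ f z b) (fderiv ℝ (fderiv ℝ f) z a c) := by
  have hd : DifferentiableAt ℝ (fderiv ℝ f) z := (fderiv_smooth hf).differentiableAt (by simp)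
  have hev (w : F) : DifferentiableAt ℝ (fun y => fderiv ℝ f y w) z := hd.clm_apply
    (differentiableAt_const w)
  have hp := fderiv_pairing (hG.differentiableAt (by simp)) (hf.differentiableAt (by simp))
    (hev b) (hev c) a
  have hP : DifferentiableAt ℝ (pull G f) z := (pull_smooth hG hf).differentiableAt (by simp)
  have h2 := ((hP.hasFDerivAt.clm_apply (hasFDerivAt_const b z)).clm_apply
    (hasFDerivAt_const c z)).fderiv
  have h3 (w : F) : fderiv ℝ (fun y => fderiv ℝ f y w) z a = fderiv ℝ (fderiv ℝ f) z a w := by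
    rw [(hd.hasFDerivAt.clm_apply (hasFDerivAt_const w z)).fderiv]
    simp
  rw [h3, h3] at hp
  rw [← hp]
  have h4 : (fun y => G (f y) (fderiv ℝ f y b) (fderiv ℝ f y c)) = fun y => pull G f y b c := rfl
  rw [h4, h2]
  simp

theorem fderiv_fderiv_symm {f : F → E} {z : F} (hf : ContDiffAt ℝ ∞ f z) (a b : F) :
    fderiv ℝ (fderiv ℝ f) z a b = fderiv ℝ (fderiv ℝ f) z b a :=
  (hf.isSymmSndFDerivAt (by simp; exact WithTop.coe_le_coe.2 le_top)) a b

/-- Symmetry of `G` is assumed near `p` and not only at `p`, because it is differentiated. -/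
theorem fderiv_metric_symm {G : E → E →L[ℝ] E →L[ℝ] ℝ} {p : E} (hG : DifferentiableAt ℝ G p)
    (hi : ∀ᶠ y in 𝓝 p, IsInner (G y)) (a b c : E) :
    fderiv ℝ G p a b c = fderiv ℝ G p a c b := by
  have h (b c : E) : fderiv ℝ (fun y => G y b c) p a = fderiv ℝ G p a b c := by
    rw [((hG.hasFDerivAt.clm_apply (hasFDerivAt_const b p)).clm_apply
      (hasFDerivAt_const c p)).fderiv]
    simp
  rw [← h b c, ← h c b]
  have : (fun y => G y b c) =ᶠ[𝓝 p] fun y => G y c b := hi.mono fun y hy => hy.1 b c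
  rw [this.fderiv_eq]

theorem christ_symm [FiniteDimensional ℝ E] {G : E → E →L[ℝ] E →L[ℝ] ℝ} {p : E} (hG : DifferentiableAt ℝ G p)
    (hi : ∀ᶠ y in 𝓝 p, IsInner (G y)) (a b : E) : christ G p a b = christ G p b a := by
  rw [christ_apply, christ_apply]
  congr 1
  ext c
  rw [koszul_apply, koszul_apply, fderiv_metric_symm hG hi c a b]
  ring

theorem metric_christ [FiniteDimensional ℝ E] {G : E → E →L[ℝ] E →L[ℝ] ℝ} {p : E} (hi : IsInner (G p)) (a b c : E) :
    G p (christ G p a b) c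
      = (fderiv ℝ G p a b c + fderiv ℝ G p b a c - fderiv ℝ G p c a b) / 2 := by
  rw [christ_apply, hi.apply_inverse, koszul_apply]

/-- Compatibility with the metric: in the sum of the two Koszul expressions everything cancels
except two equal terms. -/
theorem fderiv_metric [FiniteDimensional ℝ E] {G : E → E →L[ℝ] E →L[ℝ] ℝ} {p : E} (hG : DifferentiableAt ℝ G p)
    (hi : ∀ᶠ y in 𝓝 p, IsInner (G y)) (a b c : E) :
    fderiv ℝ G p a b c = G p (christ G p a b) c + G p b (christ G p a c) := by
  have hp := hi.self_of_nhds
  rw [hp.1 b, metric_christ hp, metric_christ hp, fderiv_metric_symm hG hi a c b,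
    fderiv_metric_symm hG hi c a b, fderiv_metric_symm hG hi b a c]
  ring

/-- Koszul's formula for the pulled-back metric has six terms with second derivatives of `f`.
Symmetry of `D²f` and of `G` cancels four of them and makes the other two equal, which absorbs the
factor `1/2`. Thus the intrinsic Christoffel symbols are the tangential part of the ambient second
derivative; for a transition map between charts this is the law of change of coordinates. -/
theorem pull_christ [FiniteDimensional ℝ E] [FiniteDimensional ℝ F] {G : E → E →L[ℝ] E →L[ℝ] ℝ} {f : F → E} {z : F}
    (hG : ContDiffAt ℝ ∞ G (f z)) (hi : ∀ᶠ y in 𝓝 (f z), IsInner (G y))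
    (hf : ContDiffAt ℝ ∞ f z) (hp : IsInner (pull G f z)) (a b c : F) :
    pull G f z (christ (pull G f) z a b) c
      = G (f z) (fderiv ℝ (fderiv ℝ f) z a b
          + christ G (f z) (fderiv ℝ f z a) (fderiv ℝ f z b)) (fderiv ℝ f z c) := by
  have hi' := hi.self_of_nhds
  rw [metric_christ hp, fderiv_pull hG hf, fderiv_pull hG hf, fderiv_pull hG hf,
    map_add, add_apply, metric_christ hi', fderiv_fderiv_symm hf b a,
    fderiv_fderiv_symm hf c a, fderiv_fderiv_symm hf c b,
    hi'.1 (fderiv ℝ f z a) (fderiv ℝ (fderiv ℝ f) z b c),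
    hi'.1 (fderiv ℝ f z b) (fderiv ℝ (fderiv ℝ f) z a c)]
  ring

end Model

/-! ### Gauss, Codazzi and Weingarten equations for an immersion of vector spaces. -/

section ModelImmersion

variable {E : Type*} [NormedAddCommGroup E] [NormedSpace ℝ E]
  {F : Type*} [NormedAddCommGroup F] [NormedSpace ℝ F]

/-- `f` is a smooth immersion at `z` into a vector space, which carries near `f z` a metric `G`
smooth at `f z`. -/
structure RiemImmersionAt (G : E → E →L[ℝ] E →L[ℝ] ℝ) (f : F → E) (z : F) : Prop where
  metric_smooth : ContDiffAt ℝ ∞ G (f z)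
  inner : ∀ᶠ y in 𝓝 (f z), IsInner (G y)
  smooth : ContDiffAt ℝ ∞ f z
  injective : Function.Injective (fderiv ℝ f z)

/-- The normal part of the Lorentz force. -/
def norLor (G σ : E → E →L[ℝ] E →L[ℝ] ℝ) (f : F → E) (z b : F) : E :=
  norOp G f z (lor G σ (f z) (fderiv ℝ f z b))

theorem tan_add_nor (G : E → E →L[ℝ] E →L[ℝ] ℝ) (f : F → E) (z : F) (ξ : E) :
    ξ = fderiv ℝ f z (tanOp G f z ξ) + norOp G f z ξ := by
  simp [norOp]

theorem cov_congr {G : E → E →L[ℝ] E →L[ℝ] ℝ} {f ξ η : F → E} {z : F} (h : ξ =ᶠ[𝓝 z] η) (u : F) :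
    cov G f ξ z u = cov G f η z u := by
  rw [cov, cov, h.fderiv_eq, h.self_of_nhds]

theorem cov_add {G : E → E →L[ℝ] E →L[ℝ] ℝ} {f ξ η : F → E} {z : F} (hξ : DifferentiableAt ℝ ξ z)
    (hη : DifferentiableAt ℝ η z) (u : F) :
    cov G f (fun y => ξ y + η y) z u = cov G f ξ z u + cov G f η z u := by
  rw [cov, cov, cov, fderiv_fun_add hξ hη, map_add, add_apply]
  abel

theorem fderiv_apply_const {V : Type*} [NormedAddCommGroup V] [NormedSpace ℝ V]
    {A : F → E →L[ℝ] V} {z : F} (hA : DifferentiableAt ℝ A z) (u : F) (a : E) :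
    fderiv ℝ (fun y => A y a) z u = fderiv ℝ A z u a := by
  rw [(hA.hasFDerivAt.clm_apply (hasFDerivAt_const a z)).fderiv]
  simp

theorem fderiv_apply_field {V : Type*} [NormedAddCommGroup V] [NormedSpace ℝ V]
    {A : F → E →L[ℝ] V} {ξ : F → E} {z : F} (hA : DifferentiableAt ℝ A z)
    (hξ : DifferentiableAt ℝ ξ z) (u : F) :
    fderiv ℝ (fun y => A y (ξ y)) z u = fderiv ℝ A z u (ξ z) + A z (fderiv ℝ ξ z u) := by
  rw [(hA.hasFDerivAt.clm_apply hξ.hasFDerivAt).fderiv]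
  simp [add_comm]

variable {G σ : E → E →L[ℝ] E →L[ℝ] ℝ} {f : F → E} {z : F}

theorem RiemImmersionAt.pull_inner (h : RiemImmersionAt G f z) : IsInner (pull G f z) :=
  pull_isInner h.inner.self_of_nhds h.injective

theorem RiemImmersionAt.secFF_symm [FiniteDimensional ℝ E] (h : RiemImmersionAt G f z) (a b : F) :
    secFF G f z a b = secFF G f z b a := by
  rw [secFF, secFF, fderiv_fderiv_symm h.smooth,
    christ_symm (h.metric_smooth.differentiableAt (by simp)) h.inner]

theorem RiemImmersionAt.smooth_christ_pull [FiniteDimensional ℝ F] (h : RiemImmersionAt G f z) :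
    ContDiffAt ℝ ∞ (christ (pull G f)) z :=
  christ_smooth (pull_smooth h.metric_smooth h.smooth) h.pull_inner

/-- The directions `u`, `v` are constant fields on `F`, so no bracket appears. Antisymmetrizing
removes the symmetric second derivatives of `ξ` and `f` and the mixed terms `Γ(df u, Dξ v)`; what
remains is the ambient curvature. -/
theorem RiemImmersionAt.cov_comm [FiniteDimensional ℝ E] (h : RiemImmersionAt G f z) {ξ : F → E}
    (hξ : ContDiffAt ℝ ∞ ξ z) (u v : F) :
    cov G f (fun y => cov G f ξ y v) z u - cov G f (fun y => cov G f ξ y u) z v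
      = riem G (f z) (fderiv ℝ f z u) (fderiv ℝ f z v) (ξ z) := by
  have hΓ : DifferentiableAt ℝ (christ G) (f z) :=
    (christ_smooth h.metric_smooth h.inner.self_of_nhds).differentiableAt (by simp)
  have hf : DifferentiableAt ℝ f z := h.smooth.differentiableAt (by simp)
  have hD : DifferentiableAt ℝ (fderiv ℝ f) z :=
    (fderiv_smooth h.smooth).differentiableAt (by simp)
  have hξ' : DifferentiableAt ℝ ξ z := hξ.differentiableAt (by simp)
  have hDξ : DifferentiableAt ℝ (fderiv ℝ ξ) z := (fderiv_smooth hξ).differentiableAt (by simp)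
  have hcomp : DifferentiableAt ℝ (fun y => christ G (f y)) z := hΓ.comp z hf
  have hDv (v : F) : DifferentiableAt ℝ (fun y => fderiv ℝ f y v) z :=
    hD.clm_apply (differentiableAt_const v)
  have hΓv (v : F) : DifferentiableAt ℝ (fun y => christ G (f y) (fderiv ℝ f y v)) z :=
    hcomp.clm_apply (hDv v)
  have key (u v : F) : fderiv ℝ (fun y => cov G f ξ y v) z u
      = fderiv ℝ (fderiv ℝ ξ) z u v
        + (fderiv ℝ (christ G) (f z) (fderiv ℝ f z u) (fderiv ℝ f z v) (ξ z)
          + christ G (f z) (fderiv ℝ (fderiv ℝ f) z u v) (ξ z)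
          + christ G (f z) (fderiv ℝ f z v) (fderiv ℝ ξ z u)) := by
    unfold cov
    rw [fderiv_fun_add (hDξ.clm_apply (differentiableAt_const v)) ((hΓv v).clm_apply hξ'),
      add_apply, fderiv_apply_const hDξ, fderiv_apply_field (hΓv v) hξ',
      fderiv_apply_field hcomp (hDv v), fderiv_apply_const hD]
    have : fderiv ℝ (fun y => christ G (f y)) z u
        = fderiv ℝ (christ G) (f z) (fderiv ℝ f z u) := by
      have := fderiv_comp z hΓ hf
      rw [show (fun y => christ G (f y)) = christ G ∘ f from rfl, this]
      rfl
    rw [this, add_apply]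
  have hr (a b c : E) : fderiv ℝ (fun y => christ G y b c) (f z) a
      = fderiv ℝ (christ G) (f z) a b c := by
    rw [fderiv_apply_const (hΓ.clm_apply (differentiableAt_const b)), fderiv_apply_const hΓ]
  rw [cov, key, cov.eq_1 G f (fun y => cov G f ξ y u), key, riem, hr, hr, cov, cov, fderiv_fderiv_symm hξ v u,
    fderiv_fderiv_symm h.smooth v u, map_add, map_add]
  abel

theorem RiemImmersionAt.cov_lor [FiniteDimensional ℝ E] (h : RiemImmersionAt G f z) (hσ : ContDiffAt ℝ ∞ σ (f z))
    {ξ : F → E} (hξ : DifferentiableAt ℝ ξ z) (u : F) :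
    cov G f (fun y => lor G σ (f y) (ξ y)) z u
      = nabLor G σ (f z) (fderiv ℝ f z u) (ξ z) + lor G σ (f z) (cov G f ξ z u) := by
  have hY : DifferentiableAt ℝ (lor G σ) (f z) :=
    (lor_smooth h.metric_smooth h.inner.self_of_nhds hσ).differentiableAt (by simp)
  have hf : DifferentiableAt ℝ f z := h.smooth.differentiableAt (by simp)
  have : fderiv ℝ (fun y => lor G σ (f y)) z u = fderiv ℝ (lor G σ) (f z) (fderiv ℝ f z u) := by
    have := fderiv_comp z hY hf
    rw [show (fun y => lor G σ (f y)) = lor G σ ∘ f from rfl, this]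
    rfl
  rw [cov, fderiv_apply_field (A := fun y => lor G σ (f y)) (hY.comp z hf) hξ, this, nabLor,
    fderiv_apply_const hY, cov, map_add]
  abel

section

variable [FiniteDimensional ℝ F]

theorem RiemImmersionAt.pull_tan (h : RiemImmersionAt G f z) (ξ : E) (c : F) :
    pull G f z (tanOp G f z ξ) c = G (f z) ξ (fderiv ℝ f z c) := by
  rw [tanOp, ContinuousLinearMap.comp_apply, h.pull_inner.apply_inverse]
  rfl

theorem RiemImmersionAt.tan_fderiv (h : RiemImmersionAt G f z) (a : F) :
    tanOp G f z (fderiv ℝ f z a) = a :=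
  h.pull_inner.eq_of_forall fun c => by rw [h.pull_tan, pull_apply]

theorem RiemImmersionAt.nor_fderiv (h : RiemImmersionAt G f z) (a : F) :
    norOp G f z (fderiv ℝ f z a) = 0 := by
  simp [norOp, h.tan_fderiv]

theorem RiemImmersionAt.tan_nor (h : RiemImmersionAt G f z) (ξ : E) :
    tanOp G f z (norOp G f z ξ) = 0 := by
  have := congrArg (tanOp G f z) (tan_add_nor G f z ξ)
  rw [map_add, h.tan_fderiv] at this
  simpa using this

end

variable [FiniteDimensional ℝ E] [FiniteDimensional ℝ F]

theorem RiemImmersionAt.lor_pull (h : RiemImmersionAt G f z) (b : F) :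
    lor (pull G f) (pull σ f) z b = tanOp G f z (lor G σ (f z) (fderiv ℝ f z b)) := by
  refine h.pull_inner.inverse_eq fun c => ?_
  rw [h.pull_tan, lor, ContinuousLinearMap.comp_apply, h.inner.self_of_nhds.apply_inverse]
  rfl

theorem RiemImmersionAt.tan_christ (h : RiemImmersionAt G f z) (a b : F) :
    tanOp G f z (fderiv ℝ (fderiv ℝ f) z a b + christ G (f z) (fderiv ℝ f z a) (fderiv ℝ f z b))
      = christ (pull G f) z a b :=
  h.pull_inner.eq_of_forall fun c => by
    rw [h.pull_tan, pull_christ h.metric_smooth h.inner h.smooth h.pull_inner]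

theorem RiemImmersionAt.gauss_formula (h : RiemImmersionAt G f z) (a b : F) :
    fderiv ℝ (fderiv ℝ f) z a b + christ G (f z) (fderiv ℝ f z a) (fderiv ℝ f z b)
      = fderiv ℝ f z (christ (pull G f) z a b) + secFF G f z a b := by
  rw [secFF, ← h.tan_christ, ← tan_add_nor]

theorem RiemImmersionAt.cov_tangent (h : RiemImmersionAt G f z) {W : F → F}
    (hW : DifferentiableAt ℝ W z) (u : F) :
    cov G f (fun y => fderiv ℝ f y (W y)) z u
      = fderiv ℝ f z (fderiv ℝ W z u + christ (pull G f) z u (W z)) + secFF G f z u (W z) := by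
  rw [cov, fderiv_apply_field ((fderiv_smooth h.smooth).differentiableAt (by simp)) hW, map_add,
    add_assoc (fderiv ℝ f z _), ← h.gauss_formula]
  abel

theorem RiemImmersionAt.smooth_secFF (h : RiemImmersionAt G f z) (a b : F) :
    ContDiffAt ℝ ∞ (fun y => secFF G f y a b) z := by
  have hD := fderiv_smooth h.smooth
  have hDD := fderiv_smooth hD
  have hΓ := (christ_smooth h.metric_smooth h.inner.self_of_nhds).comp z h.smooth
  exact (norOp_smooth h.metric_smooth h.pull_inner h.smooth).clm_apply
    (((hDD.clm_apply contDiffAt_const).clm_apply contDiffAt_const).add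
      ((hΓ.clm_apply (hD.clm_apply contDiffAt_const)).clm_apply (hD.clm_apply contDiffAt_const)))

/-- Apply `cov_comm` to the field `df c`, whose first derivatives split by the Gauss formula. The
immersion hypothesis is needed near `z` because that splitting is differentiated. The last
difference is left unsplit: its tangential part yields the Gauss equation and its normal part the
Codazzi equation. -/
theorem gauss_codazzi (h : ∀ᶠ y in 𝓝 z, RiemImmersionAt G f y) (u v c : F) :
    riem G (f z) (fderiv ℝ f z u) (fderiv ℝ f z v) (fderiv ℝ f z c)
      = fderiv ℝ f z (riem (pull G f) z u v c)
        + (secFF G f z u (christ (pull G f) z v c) - secFF G f z v (christ (pull G f) z u c))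
        + (cov G f (fun y => secFF G f y v c) z u - cov G f (fun y => secFF G f y u c) z v) := by
  have hz := h.self_of_nhds
  have hD := fderiv_smooth hz.smooth
  have hΓ (v : F) : ContDiffAt ℝ ∞ (fun y => christ (pull G f) y v c) z :=
    (hz.smooth_christ_pull.clm_apply contDiffAt_const).clm_apply contDiffAt_const
  have key (u v : F) : cov G f (fun y => cov G f (fun y => fderiv ℝ f y c) y v) z u
      = fderiv ℝ f z (fderiv ℝ (fun y => christ (pull G f) y v c) z u
          + christ (pull G f) z u (christ (pull G f) z v c))
        + secFF G f z u (christ (pull G f) z v c) + cov G f (fun y => secFF G f y v c) z u := by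
    have hev : (fun y => cov G f (fun y => fderiv ℝ f y c) y v) =ᶠ[𝓝 z]
        fun y => fderiv ℝ f y (christ (pull G f) y v c) + secFF G f y v c := by
      filter_upwards [h] with y hy
      rw [hy.cov_tangent (differentiableAt_const c)]
      simp
    rw [cov_congr hev, cov_add ((hD.clm_apply (hΓ v)).differentiableAt (by simp))
      ((hz.smooth_secFF v c).differentiableAt (by simp)),
      hz.cov_tangent ((hΓ v).differentiableAt (by simp))]
  rw [← hz.cov_comm (ξ := fun y => fderiv ℝ f y c) (hD.clm_apply contDiffAt_const), key, key, riem,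
    map_sub]
  abel

/-- Differentiate `⟨ξ, df c⟩ = 0`. Compatibility with the metric gives `⟨∇ξ, df c⟩ + ⟨ξ, ∇(df c)⟩ =
0`, and by the Gauss formula only `II` survives the pairing with the normal vector `ξ`. -/
theorem weingarten (h : ∀ᶠ y in 𝓝 z, RiemImmersionAt G f y) {ξ : F → E}
    (hξ : DifferentiableAt ℝ ξ z) (hn : ∀ᶠ y in 𝓝 z, tanOp G f y (ξ y) = 0) (u c : F) :
    G (f z) (cov G f ξ z u) (fderiv ℝ f z c) = - G (f z) (secFF G f z u c) (ξ z) := by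
  have hz := h.self_of_nhds
  have hi := hz.inner.self_of_nhds
  have hGd : DifferentiableAt ℝ G (f z) := hz.metric_smooth.differentiableAt (by simp)
  have hD : DifferentiableAt ℝ (fderiv ℝ f) z :=
    (fderiv_smooth hz.smooth).differentiableAt (by simp)
  have h0 : (fun y => G (f y) (ξ y) (fderiv ℝ f y c)) =ᶠ[𝓝 z] fun _ => 0 := by
    filter_upwards [h, hn] with y hy hy'
    rw [← hy.pull_tan, hy', map_zero, zero_apply]
  have h1 := fderiv_pairing hGd (hz.smooth.differentiableAt (by simp)) hξ
    (hD.clm_apply (differentiableAt_const c)) u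
  rw [h0.fderiv_eq, fderiv_apply_const hD, fderiv_metric hGd hz.inner] at h1
  have h2 : G (f z) (ξ z) (fderiv ℝ (fderiv ℝ f) z u c
      + christ G (f z) (fderiv ℝ f z u) (fderiv ℝ f z c)) = G (f z) (secFF G f z u c) (ξ z) := by
    rw [hz.gauss_formula, map_add, ← hz.pull_tan, hn.self_of_nhds, map_zero, zero_apply, zero_add,
      hi.1]
  rw [map_add] at h2
  rw [cov, map_add, add_apply]
  simp only [fderiv_fun_const, Pi.zero_apply, zero_apply] at h1
  linarith

theorem smooth_norLor (h : RiemImmersionAt G f z) (hσ : ContDiffAt ℝ ∞ σ (f z)) (b : F) :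
    ContDiffAt ℝ ∞ (fun y => norLor G σ f y b) z :=
  (norOp_smooth h.metric_smooth h.pull_inner h.smooth).clm_apply
    (((lor_smooth h.metric_smooth h.inner.self_of_nhds hσ).comp z h.smooth).clm_apply
      ((fderiv_smooth h.smooth).clm_apply contDiffAt_const))

/-- Differentiate `Y^M(df b) = df(Y^N b) + Y^⊥ b` along `a`: the left side by the Leibniz rule
`cov_lor`, the first term on the right by the Gauss formula. The last term arises because the
ambient derivative of `df b` has the normal component `II(a, b)`, to which `Y^M` is applied. -/
theorem nabLor_immersion (h : ∀ᶠ y in 𝓝 z, RiemImmersionAt G f y)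
    (hσ : ContDiffAt ℝ ∞ σ (f z)) (a b : F) :
    nabLor G σ (f z) (fderiv ℝ f z a) (fderiv ℝ f z b)
      = fderiv ℝ f z (nabLor (pull G f) (pull σ f) z a b)
        - norLor G σ f z (christ (pull G f) z a b)
        + secFF G f z a (lor (pull G f) (pull σ f) z b)
        + cov G f (fun y => norLor G σ f y b) z a
        - lor G σ (f z) (secFF G f z a b) := by
  have hz := h.self_of_nhds
  have hD := fderiv_smooth hz.smooth
  have hY : ContDiffAt ℝ ∞ (fun y => lor (pull G f) (pull σ f) y b) z :=
    (lor_smooth (pull_smooth hz.metric_smooth hz.smooth) hz.pull_inner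
      (pull_smooth hσ hz.smooth)).clm_apply contDiffAt_const
  have h1 := hz.cov_lor hσ ((hD.clm_apply (contDiffAt_const (c := b))).differentiableAt (by simp)) a
  have hev : (fun y => lor G σ (f y) (fderiv ℝ f y b)) =ᶠ[𝓝 z] fun y =>
      fderiv ℝ f y (lor (pull G f) (pull σ f) y b) + norLor G σ f y b := by
    filter_upwards [h] with y hy
    rw [hy.lor_pull, norLor, ← tan_add_nor]
  have h2 : cov G f (fun y => fderiv ℝ f y b) z a
      = fderiv ℝ f z (christ (pull G f) z a b) + secFF G f z a b := by
    rw [hz.cov_tangent (differentiableAt_const b)]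
    simp
  rw [cov_congr hev, cov_add ((hD.clm_apply hY).differentiableAt (by simp))
      ((smooth_norLor hz hσ b).differentiableAt (by simp)),
      hz.cov_tangent (hY.differentiableAt (by simp)), h2, map_add] at h1
  have h3 := tan_add_nor G f z (lor G σ (f z) (fderiv ℝ f z (christ (pull G f) z a b)))
  rw [← hz.lor_pull] at h3
  rw [map_add (lor G σ (f z)), h3] at h1
  rw [nabLor.eq_1 (pull G f), map_sub, map_add, norLor, eq_sub_of_add_eq h1.symm]
  abel

end ModelImmersion

/-! ### Coordinate expressions of vectors, maps and tensor fields. -/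

section Charts

variable {E : Type*} [NormedAddCommGroup E] [NormedSpace ℝ E]
  {M : Type*} [TopologicalSpace M] [ChartedSpace E M]
  {F : Type*} [NormedAddCommGroup F] [NormedSpace ℝ F]
  {N : Type*} [TopologicalSpace N] [ChartedSpace F N]

variable (E) in
/-- The preferred chart at `m`. -/
def coord (m : M) : M → E := extChartAt 𝓘(ℝ, E) m

variable (E) in
/-- The inverse of the preferred chart at `m`. -/
def coordInv (m : M) : E → M := (extChartAt 𝓘(ℝ, E) m).symm

theorem coordInv_coord {m y : M} (h : y ∈ (chartAt E m).source) : coordInv E m (coord E m y) = y :=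
  (extChartAt 𝓘(ℝ, E) m).left_inv (by simpa using h)

theorem continuousAt_coordInv {m y : M} (h : y ∈ (chartAt E m).source) :
    Tendsto (coordInv E m) (𝓝 (coord E m y)) (𝓝 y) := by
  have := continuousAt_extChartAt_symm' (I := 𝓘(ℝ, E)) (x := m) (x' := y) (by simpa using h)
  have h2 := coordInv_coord h
  unfold ContinuousAt at this
  change Tendsto (coordInv E m) _ (𝓝 (coordInv E m (coord E m y))) at this
  rwa [h2] at this

theorem eventually_coord {m y : M} (h : y ∈ (chartAt E m).source) {p : M → Prop}
    (hp : ∀ᶠ y' in 𝓝 y, p y') : ∀ᶠ z in 𝓝 (coord E m y), p (coordInv E m z) :=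
  (continuousAt_coordInv h).eventually hp

theorem eventually_coord_eq {m y : M} (h : y ∈ (chartAt E m).source) :
    ∀ᶠ z in 𝓝 (coord E m y), coord E m (coordInv E m z) = z := by
  have := extChartAt_target_mem_nhds' (I := 𝓘(ℝ, E)) (x := m)
    (y := extChartAt 𝓘(ℝ, E) m y) (by
      exact (extChartAt 𝓘(ℝ, E) m).map_source (by simpa using h))
  filter_upwards [this] with z hz
  exact (extChartAt 𝓘(ℝ, E) m).right_inv hz

omit [NormedSpace ℝ E] in
theorem eventually_source {m y : M} (h : y ∈ (chartAt E m).source) :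
    ∀ᶠ y' in 𝓝 y, y' ∈ (chartAt E m).source :=
  (chartAt E m).open_source.mem_nhds h

variable (E F) in
/-- The expression of a map between manifolds in the preferred charts at `n` and `m`. -/
def localMap (m : M) (f : N → M) (n : N) : F → E := fun z => coord E m (f (coordInv F n z))

theorem localMap_coord {m : M} {f : N → M} {n y : N} (h : y ∈ (chartAt F n).source) :
    localMap E F m f n (coord F n y) = coord E m (f y) := by
  rw [localMap, coordInv_coord h]

variable [IsManifold 𝓘(ℝ, E) ∞ M] [IsManifold 𝓘(ℝ, F) ∞ N]

/-- The components, in the preferred chart at `m`, of tangent vectors at `y`. -/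
def comps (m y : M) : TangentSpace 𝓘(ℝ, E) y →L[ℝ] E :=
  (trivializationAt E (TangentSpace 𝓘(ℝ, E) : M → Type _) m).continuousLinearMapAt ℝ y

/-- The tangent vector at `y` with given components in the preferred chart at `m`. -/
def ofComps (m y : M) : E →L[ℝ] TangentSpace 𝓘(ℝ, E) y :=
  (trivializationAt E (TangentSpace 𝓘(ℝ, E) : M → Type _) m).symmL ℝ y

theorem comps_ofComps {m y : M} (h : y ∈ (chartAt E m).source) (a : E) :
    comps m y (ofComps m y a) = a :=
  Bundle.Trivialization.continuousLinearMapAt_symmL _ h a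

theorem ofComps_comps {m y : M} (h : y ∈ (chartAt E m).source) (v : TangentSpace 𝓘(ℝ, E) y) :
    ofComps m y (comps m y v) = v :=
  Bundle.Trivialization.symmL_continuousLinearMapAt _ h v

theorem comps_injective {m y : M} (h : y ∈ (chartAt E m).source) :
    Function.Injective (comps (E := E) m y) :=
  Function.LeftInverse.injective (ofComps_comps h)

theorem comps_surjective {m y : M} (h : y ∈ (chartAt E m).source) :
    Function.Surjective (comps (E := E) m y) :=
  Function.RightInverse.surjective (comps_ofComps h)

theorem comps_apply {m y : M} (h : y ∈ (chartAt E m).source) (v : TangentSpace 𝓘(ℝ, E) y) :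
    comps m y v = (trivializationAt E (TangentSpace 𝓘(ℝ, E) : M → Type _) m
      (⟨y, v⟩ : TangentBundle 𝓘(ℝ, E) M)).2 :=
  Bundle.Trivialization.continuousLinearMapAt_apply_of_mem ℝ _ h v

theorem symm_eq_ofComps {m y : M} (h : y ∈ (chartAt E m).source) (a : E) :
    (trivializationAt E (TangentSpace 𝓘(ℝ, E) : M → Type _) m).symm y a = ofComps m y a :=
  (Bundle.Trivialization.symmL_apply _ h a).symm

theorem coordField_eq {x y : M} (h : y ∈ (chartAt E x).source) (v : TangentSpace 𝓘(ℝ, E) x) :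
    coordField v y = ofComps x y (comps x x v) := by
  rw [comps_apply (mem_chart_source E x), ← symm_eq_ofComps h]
  rfl

theorem comps_coordField {x y : M} (h : y ∈ (chartAt E x).source) (v : TangentSpace 𝓘(ℝ, E) x) :
    comps x y (coordField v y) = comps x x v := by
  rw [coordField_eq h, comps_ofComps h]

/-- The trivialization of the tangent bundle at `m` is the derivative of the chart at `m`; this
links bundle components with ordinary derivatives in coordinates. -/
theorem hasMFDerivAt_coord {m y : M} (h : y ∈ (chartAt E m).source) :
    HasMFDerivAt 𝓘(ℝ, E) 𝓘(ℝ, E) (coord E m) y (comps m y) := by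
  have := (mdifferentiableAt_extChartAt (I := 𝓘(ℝ, E)) h).hasMFDerivAt
  rwa [← TangentBundle.continuousLinearMapAt_trivializationAt h] at this

theorem contDiffAt_localMap {m : M} {f : N → M} {n y : N}
    (hf : ContMDiffAt 𝓘(ℝ, F) 𝓘(ℝ, E) ∞ f y) (h : y ∈ (chartAt F n).source)
    (h' : f y ∈ (chartAt E m).source) :
    ContDiffAt ℝ ∞ (localMap E F m f n) (coord F n y) := by
  have := ((contMDiffAt_iff_of_mem_source h h').1 hf).2
  simp only [modelWithCornersSelf_coe, Set.range_id, contDiffWithinAt_univ] at this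
  exact this

/-- The derivative at `y` of a vector-valued function which is differentiable in a chart. -/
theorem mvfderiv_eq {V : Type*} [NormedAddCommGroup V] [NormedSpace ℝ V] {h : N → V} {n y : N}
    (hy : y ∈ (chartAt F n).source)
    (hd : DifferentiableAt ℝ (fun z => h (coordInv F n z)) (coord F n y))
    (u : TangentSpace 𝓘(ℝ, F) y) :
    mvfderiv 𝓘(ℝ, F) h y u
      = fderiv ℝ (fun z => h (coordInv F n z)) (coord F n y) (comps n y u) := by
  have h1 := (hd.hasFDerivAt.hasMFDerivAt).comp y (hasMFDerivAt_coord hy)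
  have h2 : h =ᶠ[𝓝 y] (fun z => h (coordInv F n z)) ∘ coord F n := by
    filter_upwards [eventually_source hy] with y' hy'
    simp [coordInv_coord hy']
  have h3 := (h1.congr_of_eventuallyEq h2).mfderiv
  rw [mvfderiv, h3]
  rfl

theorem comps_mfderiv {m : M} {f : N → M} {n y : N}
    (hf : ContMDiffAt 𝓘(ℝ, F) 𝓘(ℝ, E) ∞ f y) (h : y ∈ (chartAt F n).source)
    (h' : f y ∈ (chartAt E m).source) (u : TangentSpace 𝓘(ℝ, F) y) :
    comps m (f y) (mfderiv 𝓘(ℝ, F) 𝓘(ℝ, E) f y u)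
      = fderiv ℝ (localMap E F m f n) (coord F n y) (comps n y u) := by
  have h1 := (hasMFDerivAt_coord h').comp y (hf.mdifferentiableAt (by simp)).hasMFDerivAt
  have h2 := mvfderiv_eq (h := fun y => coord E m (f y)) h
    ((contDiffAt_localMap hf h h').differentiableAt (by simp)) u
  refine Eq.trans ?_ h2
  rw [mvfderiv]
  have h3 := h1.mfderiv
  change mfderiv 𝓘(ℝ, F) 𝓘(ℝ, E) (fun y => coord E m (f y)) y = _ at h3
  rw [h3]
  rfl

/-- The expression of a tensor field in the preferred chart at `m`. -/
def localTensor (τ : TwoTensor E M) (m : M) (z : E) : E →L[ℝ] E →L[ℝ] ℝ :=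
  ((ofComps m (coordInv E m z)).precomp ℝ) ∘L (τ (coordInv E m z) ∘L ofComps m (coordInv E m z))

theorem localTensor_apply (τ : TwoTensor E M) (m : M) (z a b : E) :
    localTensor τ m z a b
      = τ (coordInv E m z) (ofComps m (coordInv E m z) a) (ofComps m (coordInv E m z) b) := rfl

theorem localTensor_coord (τ : TwoTensor E M) {m y : M} (h : y ∈ (chartAt E m).source)
    (u v : TangentSpace 𝓘(ℝ, E) y) :
    localTensor τ m (coord E m y) (comps m y u) (comps m y v) = τ y u v := by
  rw [localTensor_apply, coordInv_coord h, ofComps_comps h, ofComps_comps h]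

theorem localTensor_eq_pull {τ' : TwoTensor F N} {τ : TwoTensor E M} {f : N → M} {m : M} {n y : N}
    (hf : ContMDiffAt 𝓘(ℝ, F) 𝓘(ℝ, E) ∞ f y) (h : y ∈ (chartAt F n).source)
    (h' : f y ∈ (chartAt E m).source)
    (hτ : ∀ u v, τ' y u v
      = τ (f y) (mfderiv 𝓘(ℝ, F) 𝓘(ℝ, E) f y u) (mfderiv 𝓘(ℝ, F) 𝓘(ℝ, E) f y v)) :
    localTensor τ' n (coord F n y)
      = pull (localTensor τ m) (localMap E F m f n) (coord F n y) := by
  ext a b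
  obtain ⟨u, rfl⟩ := comps_surjective h a
  obtain ⟨v, rfl⟩ := comps_surjective h b
  rw [localTensor_coord τ' h, pull_apply, ← comps_mfderiv hf h h', ← comps_mfderiv hf h h',
    localMap_coord h, localTensor_coord τ h', hτ]

/-- Christoffel symbols and curvature differentiate the metric, so an equality of germs is required.
It is used with `f = ι` for the induced tensors, and with `f` the identity for changes of chart. -/
theorem eventually_localTensor_eq_pull {τ' : TwoTensor F N} {τ : TwoTensor E M} {f : N → M} {m : M}
    {n y : N} (hf : ContMDiff 𝓘(ℝ, F) 𝓘(ℝ, E) ∞ f) (h : y ∈ (chartAt F n).source)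
    (h' : f y ∈ (chartAt E m).source)
    (hτ : ∀ y u v, τ' y u v
      = τ (f y) (mfderiv 𝓘(ℝ, F) 𝓘(ℝ, E) f y u) (mfderiv 𝓘(ℝ, F) 𝓘(ℝ, E) f y v)) :
    localTensor τ' n =ᶠ[𝓝 (coord F n y)] pull (localTensor τ m) (localMap E F m f n) := by
  have h1 : ∀ᶠ y' in 𝓝 y, f y' ∈ (chartAt E m).source :=
    hf.continuous.continuousAt.eventually (eventually_source h')
  filter_upwards [eventually_coord h (h1.and (eventually_source h)), eventually_coord_eq h]
    with z hz hz'
  rw [← hz']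
  exact localTensor_eq_pull (hf _) hz.2 hz.1 (hτ _)

/-- The Riemannian metrics among the tensor fields. -/
structure IsRiemannian (g : TwoTensor E M) : Prop where
  symm : ∀ (y : M) (u v : TangentSpace 𝓘(ℝ, E) y), g y u v = g y v u
  pos : ∀ (y : M) (u : TangentSpace 𝓘(ℝ, E) y), u ≠ 0 → 0 < g y u u

/-- Smoothness of a tensor field, in the preferred charts. -/
def IsSmooth (τ : TwoTensor E M) : Prop :=
  ∀ m y : M, y ∈ (chartAt E m).source → ContDiffAt ℝ ∞ (localTensor τ m) (coord E m y)

theorem IsRiemannian.isInner {g : TwoTensor E M} (hg : IsRiemannian g) {m y : M}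
    (h : y ∈ (chartAt E m).source) : IsInner (localTensor g m (coord E m y)) := by
  constructor
  · intro a b
    exact hg.symm _ _ _
  · intro a ha
    rw [localTensor_apply, coordInv_coord h]
    refine hg.pos _ _ fun h0 => ha ?_
    rw [← comps_ofComps h a, h0, map_zero]

theorem IsRiemannian.eventually_isInner {g : TwoTensor E M} (hg : IsRiemannian g) {m y : M}
    (h : y ∈ (chartAt E m).source) :
    ∀ᶠ z in 𝓝 (coord E m y), IsInner (localTensor g m z) := by
  filter_upwards [eventually_coord h (eventually_source h), eventually_coord_eq h] with z hz hz'
  rw [← hz']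
  exact hg.isInner hz

theorem contMDiffOn_ofComps (m : M) (a : E) :
    ContMDiffOn 𝓘(ℝ, E) 𝓘(ℝ, E).tangent ∞
      (fun y => (⟨y, ofComps m y a⟩ : TangentBundle 𝓘(ℝ, E) M)) (chartAt E m).source := by
  have := (trivializationAt E (TangentSpace 𝓘(ℝ, E) : M → Type _)
    m).contMDiffOn_section_baseSet_iff (IB := 𝓘(ℝ, E)) (n := ∞) (s := fun y => ofComps m y a)
  refine this.2 ?_
  refine (contMDiffOn_const (c := a)).congr fun y hy => ?_
  rw [← comps_apply hy, comps_ofComps hy]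

/-- In finite dimension smoothness can be tested on pairs of constant vectors. These correspond to
the local frame fields `ofComps m · a`, which are smooth on the chart domain. -/
theorem isSmooth_of_contMDiff [FiniteDimensional ℝ E] {τ : TwoTensor E M}
    (hτ : ContMDiff 𝓘(ℝ, E) (𝓘(ℝ, E).prod 𝓘(ℝ, E →L[ℝ] E →L[ℝ] ℝ)) ∞
      (fun x : M => Bundle.TotalSpace.mk' (E →L[ℝ] E →L[ℝ] ℝ)
        (E := fun x : M => TangentSpace 𝓘(ℝ, E) x →L[ℝ] TangentSpace 𝓘(ℝ, E) x →L[ℝ] ℝ)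
        x (τ x))) : IsSmooth τ := by
  intro m y hy
  have hmem : coord E m y ∈ (extChartAt 𝓘(ℝ, E) m).target :=
    (extChartAt 𝓘(ℝ, E) m).map_source (by simpa using hy)
  suffices ContDiffOn ℝ ∞ (localTensor τ m) (extChartAt 𝓘(ℝ, E) m).target from
    this.contDiffAt ((isOpen_extChartAt_target m).mem_nhds hmem)
  refine contDiffOn_clm_apply.2 fun a => contDiffOn_clm_apply.2 fun b => ?_
  have h1 : ContMDiffOn 𝓘(ℝ, E) 𝓘(ℝ, ℝ) ∞ (fun y => τ y (ofComps m y a) (ofComps m y b))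
      (chartAt E m).source := by
    intro y hy
    have := (hτ.contMDiffOn (s := (chartAt E m).source) y hy).clm_bundle_apply₂
      (E₃ := fun _ : M => ℝ) (F₃ := ℝ)
      (contMDiffOn_ofComps m a y hy) (contMDiffOn_ofComps m b y hy)
    exact Bundle.contMDiffWithinAt_section.1 this
  have h2 := h1.comp (contMDiffOn_extChartAt_symm (I := 𝓘(ℝ, E)) (n := ∞) m) (by
    intro z hz
    simpa using (extChartAt 𝓘(ℝ, E) m).map_target hz)
  exact h2.contDiffOn

end Charts

/-! ### Independence of the covariant derivative from the chart. -/

section Transfer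

variable {E : Type*} [NormedAddCommGroup E] [NormedSpace ℝ E]
  {F : Type*} [NormedAddCommGroup F] [NormedSpace ℝ F]

theorem christ_congr {G H : E → E →L[ℝ] E →L[ℝ] ℝ} {p : E} (h : G =ᶠ[𝓝 p] H) :
    christ G p = christ H p := by
  rw [christ, christ, h.fderiv_eq, h.self_of_nhds]

variable {M : Type*} [TopologicalSpace M] [ChartedSpace E M] [IsManifold 𝓘(ℝ, E) ∞ M]
  {N : Type*} [TopologicalSpace N] [ChartedSpace F N] [IsManifold 𝓘(ℝ, F) ∞ N]

/-- `Classical.epsilon` satisfies its specification only once a solution is exhibited; uniqueness by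
definiteness then identifies its choice with the explicit inverse. -/
theorem comps_rieszVec [FiniteDimensional ℝ E] {g : TwoTensor E M} (hg : IsRiemannian g) {m y : M}
    (h : y ∈ (chartAt E m).source) {α : TangentSpace 𝓘(ℝ, E) y → ℝ} (ℓ : E →L[ℝ] ℝ)
    (hα : ∀ w, α w = ℓ (comps m y w)) :
    comps m y (rieszVec (fun a b => g y a b) α) = (localTensor g m (coord E m y)).inverse ℓ := by
  have hi := hg.isInner h
  have hex : ∃ u : TangentSpace 𝓘(ℝ, E) y, ∀ w, g y u w = α w := by
    refine ⟨ofComps m y ((localTensor g m (coord E m y)).inverse ℓ), fun w => ?_⟩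
    rw [← localTensor_coord g h, comps_ofComps h, hi.apply_inverse, hα]
  have hs := Classical.epsilon_spec hex
  refine (hi.inverse_eq fun a => ?_).symm
  obtain ⟨w, rfl⟩ := comps_surjective h a
  rw [localTensor_coord g h, ← hα]
  exact hs w

theorem mvfderiv_tensor {g : TwoTensor E M} (hs : IsSmooth g) {x : M}
    (u v w : TangentSpace 𝓘(ℝ, E) x) :
    mvfderiv 𝓘(ℝ, E) (fun y => g y (coordField v y) (coordField w y)) x u
      = fderiv ℝ (localTensor g x) (coord E x x) (comps x x u) (comps x x v) (comps x x w) := by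
  have hx := mem_chart_source E x
  have hd : DifferentiableAt ℝ (localTensor g x) (coord E x x) :=
    (hs x x hx).differentiableAt (by simp)
  have hev : (fun z => g (coordInv E x z) (coordField v (coordInv E x z))
      (coordField w (coordInv E x z))) =ᶠ[𝓝 (coord E x x)]
      fun z => localTensor g x z (comps x x v) (comps x x w) := by
    filter_upwards [eventually_coord hx (eventually_source hx)] with z hz
    rw [localTensor_apply, coordField_eq hz, coordField_eq hz]
  have hd' := hd.clm_apply (differentiableAt_const (comps x x v))
  rw [mvfderiv_eq (h := fun y => g y (coordField v y) (coordField w y)) hx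
    ((hd'.clm_apply (differentiableAt_const _)).congr_of_eventuallyEq hev), hev.fderiv_eq,
    fderiv_apply_const hd', fderiv_apply_const hd]

theorem comps_christoffel [FiniteDimensional ℝ E] {g : TwoTensor E M} (hg : IsRiemannian g)
    (hs : IsSmooth g) (x : M) (u v : TangentSpace 𝓘(ℝ, E) x) :
    comps x x (christoffel g x u v)
      = christ (localTensor g x) (coord E x x) (comps x x u) (comps x x v) := by
  rw [christoffel, christ_apply]
  refine comps_rieszVec hg (mem_chart_source E x) _ fun w => ?_
  rw [mvfderiv_tensor hs, mvfderiv_tensor hs, mvfderiv_tensor hs, koszul_apply]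

theorem comps_change {m p y : M} (hm : y ∈ (chartAt E m).source) (hp : y ∈ (chartAt E p).source)
    (v : TangentSpace 𝓘(ℝ, E) y) :
    fderiv ℝ (localMap E E p (fun y : M => y) m) (coord E m y) (comps m y v) = comps p y v := by
  rw [← comps_mfderiv (f := fun y : M => y) contMDiffAt_id hm hp]
  have : mfderiv 𝓘(ℝ, E) 𝓘(ℝ, E) (fun y : M => y) y = ContinuousLinearMap.id ℝ _ := mfderiv_id
  rw [this]
  rfl

theorem christ_change [FiniteDimensional ℝ E] {g : TwoTensor E M} (hg : IsRiemannian g)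
    (hs : IsSmooth g) {m p y : M} (hm : y ∈ (chartAt E m).source) (hp : y ∈ (chartAt E p).source)
    (a b : E) :
    fderiv ℝ (localMap E E p (fun y : M => y) m) (coord E m y)
        (christ (localTensor g m) (coord E m y) a b)
      = fderiv ℝ (fderiv ℝ (localMap E E p (fun y : M => y) m)) (coord E m y) a b
        + christ (localTensor g p) (coord E p y)
          (fderiv ℝ (localMap E E p (fun y : M => y) m) (coord E m y) a)
          (fderiv ℝ (localMap E E p (fun y : M => y) m) (coord E m y) b) := by
  have hloc : localMap E E p (fun y : M => y) m (coord E m y) = coord E p y := localMap_coord hm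
  have hmf (y : M) : mfderiv 𝓘(ℝ, E) 𝓘(ℝ, E) (fun y : M => y) y = ContinuousLinearMap.id ℝ _ :=
    mfderiv_id
  have hpull : localTensor g m =ᶠ[𝓝 (coord E m y)]
      pull (localTensor g p) (localMap E E p (fun y : M => y) m) :=
    eventually_localTensor_eq_pull (f := fun y : M => y) contMDiff_id hm hp fun y u v => by
      rw [hmf]
      rfl
  refine (hg.isInner hp).eq_of_forall fun c' => ?_
  -- The derivative of the transition map is onto, so it suffices to test against its values, as
  -- `pull_christ` does.
  obtain ⟨c, rfl⟩ : ∃ c, fderiv ℝ (localMap E E p (fun y : M => y) m) (coord E m y) c = c' := by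
    obtain ⟨v, rfl⟩ := comps_surjective hp c'
    exact ⟨_, comps_change hm hp v⟩
  have h1 := pull_christ (G := localTensor g p) (f := localMap E E p (fun y : M => y) m)
    (z := coord E m y) (by rw [hloc]; exact hs p y hp)
    (by rw [hloc]; exact hg.eventually_isInner hp)
    (contDiffAt_localMap (f := fun y : M => y) contMDiffAt_id hm hp)
    (by rw [← hpull.self_of_nhds]; exact hg.isInner hm) a b c
  rw [← christ_congr hpull, pull_apply, hloc] at h1
  exact h1

/-- With `κ` the transition map from the chart at `m` to that at `f y`, the components in the latter
are `Dκ ξ'`. The product rule produces a term `D²κ(df u, ξ')`, which is exactly the inhomogeneous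
term in the transformation law of the Christoffel symbols. Since `y` may vary in the charts,
covariant derivatives can be iterated. -/
theorem comps_covAlong [FiniteDimensional ℝ E] {g : TwoTensor E M} (hg : IsRiemannian g)
    (hs : IsSmooth g) {f : N → M} (hf : ContMDiff 𝓘(ℝ, F) 𝓘(ℝ, E) ∞ f) {m : M} {n y : N}
    (hy : y ∈ (chartAt F n).source) (hfy : f y ∈ (chartAt E m).source)
    {ξ : ∀ b : N, TangentSpace 𝓘(ℝ, E) (f b)} {ξ' : F → E}
    (hξ : ∀ᶠ z in 𝓝 (coord F n y), comps m (f (coordInv F n z)) (ξ (coordInv F n z)) = ξ' z)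
    (hd : DifferentiableAt ℝ ξ' (coord F n y)) (u : TangentSpace 𝓘(ℝ, F) y) :
    comps m (f y) (covAlong g f ξ y u)
      = cov (localTensor g m) (localMap E F m f n) ξ' (coord F n y) (comps n y u) := by
  have hpp := mem_chart_source E (f y)
  set κ := localMap E E (f y) (fun y : M => y) m with hκ
  have hκs : ContDiffAt ℝ ∞ κ (coord E m (f y)) :=
    contDiffAt_localMap (f := fun y : M => y) contMDiffAt_id hfy hpp
  have hfs := contDiffAt_localMap (hf y) hy hfy
  have hloc : localMap E F m f n (coord F n y) = coord E m (f y) := localMap_coord hy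
  have hinj : Function.Injective (fderiv ℝ κ (coord E m (f y))) := by
    intro a b hab
    obtain ⟨v, rfl⟩ := comps_surjective hfy a
    obtain ⟨w, rfl⟩ := comps_surjective hfy b
    rw [comps_change hfy hpp, comps_change hfy hpp] at hab
    rw [comps_injective hpp hab]
  -- The definition of `covAlong` lives in the chart at `f y`; applying `Dκ` moves the comparison
  -- there.
  apply hinj
  rw [comps_change hfy hpp, covAlong, map_add, symm_eq_ofComps hpp, comps_ofComps hpp,
    comps_christoffel hg hs]
  have hev : (fun z => (trivializationAt E (TangentSpace 𝓘(ℝ, E) : M → Type _) (f y)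
      (⟨f (coordInv F n z), ξ (coordInv F n z)⟩ : TangentBundle 𝓘(ℝ, E) M)).2)
      =ᶠ[𝓝 (coord F n y)] fun z => fderiv ℝ κ (localMap E F m f n z) (ξ' z) := by
    have h1 : ∀ᶠ y' in 𝓝 y, f y' ∈ (chartAt E m).source ∧ f y' ∈ (chartAt E (f y)).source :=
      hf.continuous.continuousAt.eventually ((eventually_source hfy).and (eventually_source hpp))
    filter_upwards [eventually_coord hy h1, hξ] with z hz hz'
    rw [← comps_apply hz.2, ← comps_change hz.1 hz.2, hz']
    rfl
  have hA : DifferentiableAt ℝ (fderiv ℝ κ) (localMap E F m f n (coord F n y)) := by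
    rw [hloc]
    exact (fderiv_smooth hκs).differentiableAt (by simp)
  have hfd : DifferentiableAt ℝ (localMap E F m f n) (coord F n y) :=
    hfs.differentiableAt (by simp)
  have hAf : DifferentiableAt ℝ (fun z => fderiv ℝ κ (localMap E F m f n z)) (coord F n y) :=
    hA.comp (coord F n y) hfd
  have hchain : fderiv ℝ (fun z => fderiv ℝ κ (localMap E F m f n z)) (coord F n y) (comps n y u)
      = fderiv ℝ (fderiv ℝ κ) (coord E m (f y))
        (fderiv ℝ (localMap E F m f n) (coord F n y) (comps n y u)) := by
    have := fderiv_comp (coord F n y) hA hfd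
    rw [hloc] at this
    rw [show (fun z => fderiv ℝ κ (localMap E F m f n z)) = fderiv ℝ κ ∘ localMap E F m f n from rfl,
      this]
    rfl
  have hξy : comps m (f y) (ξ y) = ξ' (coord F n y) := by
    have := hξ.self_of_nhds
    rwa [coordInv_coord hy] at this
  rw [mvfderiv_eq (h := fun b => (trivializationAt E (TangentSpace 𝓘(ℝ, E) : M → Type _) (f y)
      (⟨f b, ξ b⟩ : TangentBundle 𝓘(ℝ, E) M)).2) hy
      ((hAf.clm_apply hd).congr_of_eventuallyEq hev), hev.fderiv_eq, fderiv_apply_field hAf hd,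
    hchain, hloc, cov, map_add, hloc, christ_change hg hs hfy hpp, ← comps_change hfy hpp (ξ y),
    ← comps_change hfy hpp (mfderiv 𝓘(ℝ, F) 𝓘(ℝ, E) f y u), comps_mfderiv (hf y) hy hfy, hξy]
  abel

end Transfer

/-! ### Connection, curvature and Lorentz force in coordinates. -/

section Intrinsic

variable {E : Type*} [NormedAddCommGroup E] [NormedSpace ℝ E]
  {M : Type*} [TopologicalSpace M] [ChartedSpace E M] [IsManifold 𝓘(ℝ, E) ∞ M]

theorem lieBracketWithin_univ_eq_zero {V W : E → E} {p a b : E} (hV : V =ᶠ[𝓝 p] fun _ => a)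
    (hW : W =ᶠ[𝓝 p] fun _ => b) : VectorField.lieBracketWithin ℝ V W Set.univ p = 0 := by
  rw [VectorField.lieBracketWithin_univ, VectorField.lieBracket, hV.fderiv_eq, hW.fderiv_eq]
  simp

/-- Pulled back by the inverse chart, both fields are constant near the point, so the bracket term
of `curvature` vanishes. -/
theorem mlieBracket_coordField (x : M) (u v : TangentSpace 𝓘(ℝ, E) x) :
    VectorField.mlieBracket 𝓘(ℝ, E) (coordField u) (coordField v) x = 0 := by
  have hx := mem_chart_source E x
  have key (u : TangentSpace 𝓘(ℝ, E) x) :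
      VectorField.mpullbackWithin 𝓘(ℝ, E) 𝓘(ℝ, E) (extChartAt 𝓘(ℝ, E) x).symm (coordField u)
        (Set.range 𝓘(ℝ, E)) =ᶠ[𝓝 (coord E x x)] fun _ => comps x x u := by
    filter_upwards [eventually_coord hx (eventually_source hx), eventually_coord_eq hx]
      with z hz hz'
    have hz2 : z ∈ (extChartAt 𝓘(ℝ, E) x).target := by
      rw [← hz']
      exact (extChartAt 𝓘(ℝ, E) x).map_source (by simpa using hz)
    have h1 := TangentBundle.symmL_trivializationAt (I := 𝓘(ℝ, E)) hz
    rw [show extChartAt 𝓘(ℝ, E) x (coordInv E x z) = z from hz'] at h1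
    have h2 := coordField_eq hz u
    rw [ofComps, h1] at h2
    exact (isInvertible_mfderivWithin_extChartAt_symm hz2).inverse_apply_eq.2 h2
  rw [← VectorField.mlieBracketWithin_univ, VectorField.mlieBracketWithin_apply]
  have hset : (extChartAt 𝓘(ℝ, E) x).symm ⁻¹' Set.univ ∩ Set.range 𝓘(ℝ, E) = Set.univ := by simp
  have h0 : VectorField.lieBracketWithin ℝ
      (VectorField.mpullbackWithin 𝓘(ℝ, E) 𝓘(ℝ, E) (extChartAt 𝓘(ℝ, E) x).symm (coordField u)
        (Set.range 𝓘(ℝ, E)))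
      (VectorField.mpullbackWithin 𝓘(ℝ, E) 𝓘(ℝ, E) (extChartAt 𝓘(ℝ, E) x).symm (coordField v)
        (Set.range 𝓘(ℝ, E)))
      ((extChartAt 𝓘(ℝ, E) x).symm ⁻¹' Set.univ ∩ Set.range 𝓘(ℝ, E)) (extChartAt 𝓘(ℝ, E) x x)
      = 0 := by
    rw [hset]
    exact lieBracketWithin_univ_eq_zero (key u) (key v)
  rw [h0]
  exact map_zero _

variable [FiniteDimensional ℝ E] {g σ : TwoTensor E M}

theorem comps_leviCivita (hg : IsRiemannian g) (hs : IsSmooth g) {m y : M}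
    (hy : y ∈ (chartAt E m).source) {X : ∀ y : M, TangentSpace 𝓘(ℝ, E) y} {X' : E → E}
    (hX : ∀ᶠ z in 𝓝 (coord E m y), comps m (coordInv E m z) (X (coordInv E m z)) = X' z)
    (hd : DifferentiableAt ℝ X' (coord E m y)) (v : TangentSpace 𝓘(ℝ, E) y) :
    comps m y (leviCivita g X y v)
      = fderiv ℝ X' (coord E m y) (comps m y v)
        + christ (localTensor g m) (coord E m y) (comps m y v) (X' (coord E m y)) := by
  have h := comps_covAlong hg hs (f := fun y : M => y) contMDiff_id hy hy hX hd v
  rw [cov, comps_change hy hy, localMap_coord hy] at h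
  exact h

theorem comps_leviCivita_coordField (hg : IsRiemannian g) (hs : IsSmooth g) {x y : M}
    (hy : y ∈ (chartAt E x).source) (w : TangentSpace 𝓘(ℝ, E) x) (v : TangentSpace 𝓘(ℝ, E) y) :
    comps x y (leviCivita g (coordField w) y v)
      = christ (localTensor g x) (coord E x y) (comps x y v) (comps x x w) := by
  rw [comps_leviCivita hg hs hy (X' := fun _ => comps x x w)
    ((eventually_coord hy (eventually_source hy)).mono fun z hz => comps_coordField hz w)
    (differentiableAt_const _)]
  simp

theorem comps_lorentz (hg : IsRiemannian g) {m y : M} (hy : y ∈ (chartAt E m).source)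
    (v : TangentSpace 𝓘(ℝ, E) y) :
    comps m y (lorentz g σ y v)
      = lor (localTensor g m) (localTensor σ m) (coord E m y) (comps m y v) :=
  comps_rieszVec hg hy (localTensor σ m (coord E m y) (comps m y v)) fun w =>
    (localTensor_coord σ hy v w).symm

theorem comps_curvature (hg : IsRiemannian g) (hs : IsSmooth g) (x : M)
    (u v w : TangentSpace 𝓘(ℝ, E) x) :
    comps x x (curvature g x u v w)
      = riem (localTensor g x) (coord E x x) (comps x x u) (comps x x v) (comps x x w) := by
  have hx := mem_chart_source E x
  have key (u v : TangentSpace 𝓘(ℝ, E) x) :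
      comps x x (leviCivita g (fun y => leviCivita g (coordField w) y (coordField v y)) x u)
        = fderiv ℝ (fun z => christ (localTensor g x) z (comps x x v) (comps x x w)) (coord E x x)
            (comps x x u)
          + christ (localTensor g x) (coord E x x) (comps x x u)
            (christ (localTensor g x) (coord E x x) (comps x x v) (comps x x w)) := by
    refine comps_leviCivita hg hs hx
      (X' := fun z => christ (localTensor g x) z (comps x x v) (comps x x w)) ?_ ?_ u
    · filter_upwards [eventually_coord hx (eventually_source hx), eventually_coord_eq hx]
        with z hz hz'
      rw [comps_leviCivita_coordField hg hs hz, comps_coordField hz, hz']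
    · exact ((christ_smooth (hs x x hx) (hg.isInner hx)).differentiableAt (by simp)).clm_apply
        (differentiableAt_const _) |>.clm_apply (differentiableAt_const _)
  rw [curvature, mlieBracket_coordField, map_sub, map_sub, key, key,
    comps_leviCivita_coordField hg hs hx, map_zero, map_zero, zero_apply, sub_zero, riem]

theorem comps_nablaLorentz (hg : IsRiemannian g) (hs : IsSmooth g) (hσ : IsSmooth σ) (x : M)
    (v w : TangentSpace 𝓘(ℝ, E) x) :
    comps x x (nablaLorentz g σ x v w)
      = nabLor (localTensor g x) (localTensor σ x) (coord E x x) (comps x x v) (comps x x w) := by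
  have hx := mem_chart_source E x
  have hev : ∀ᶠ z in 𝓝 (coord E x x),
      comps x (coordInv E x z) (lorentz g σ (coordInv E x z) (coordField w (coordInv E x z)))
        = lor (localTensor g x) (localTensor σ x) z (comps x x w) := by
    filter_upwards [eventually_coord hx (eventually_source hx), eventually_coord_eq hx]
      with z hz hz'
    rw [comps_lorentz hg hz, comps_coordField hz, hz']
  rw [nablaLorentz, map_sub, comps_leviCivita hg hs hx hev
    (((lor_smooth (hs x x hx) (hg.isInner hx) (hσ x x hx)).differentiableAt (by simp)).clm_apply
      (differentiableAt_const _)), comps_lorentz hg hx, comps_leviCivita_coordField hg hs hx, nabLor]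

omit [FiniteDimensional ℝ E] in
theorem comps_projLine {m y : M} (hy : y ∈ (chartAt E m).source) (v w : TangentSpace 𝓘(ℝ, E) y) :
    comps m y (projLine g y v w)
      = (localTensor g m (coord E m y) (comps m y v) (comps m y w)
          / localTensor g m (coord E m y) (comps m y v) (comps m y v)) • comps m y v := by
  rw [projLine, map_smul, localTensor_coord g hy, localTensor_coord g hy]

end Intrinsic

/-! ### Tangential and normal parts and the second fundamental form in coordinates. -/

section Extrinsic

variable {E : Type*} [NormedAddCommGroup E] [NormedSpace ℝ E] [FiniteDimensional ℝ E]
  {M : Type*} [TopologicalSpace M] [ChartedSpace E M] [IsManifold 𝓘(ℝ, E) ∞ M]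
  {F : Type*} [NormedAddCommGroup F] [NormedSpace ℝ F] [FiniteDimensional ℝ F]
  {N : Type*} [TopologicalSpace N] [ChartedSpace F N] [IsManifold 𝓘(ℝ, F) ∞ N]
  {g σ : TwoTensor E M} {ι : N → M}

omit [FiniteDimensional ℝ E] [FiniteDimensional ℝ F] [IsManifold 𝓘(ℝ, E) ∞ M]
  [IsManifold 𝓘(ℝ, F) ∞ N] in
theorem induced_isRiemannian (hg : IsRiemannian g)
    (hinj : ∀ y, Function.Injective (dmap (E := E) (F := F) ι y)) :
    IsRiemannian (induced (F := F) ι g) :=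
  ⟨fun _ _ _ => hg.symm _ _ _, fun y _ hu => hg.pos _ _ fun h =>
    hu (hinj y (h.trans (map_zero (dmap ι y)).symm))⟩

omit [FiniteDimensional ℝ E] [FiniteDimensional ℝ F] in
theorem localTensor_induced (hι : ContMDiff 𝓘(ℝ, F) 𝓘(ℝ, E) ∞ ι) (τ : TwoTensor E M) {m : M}
    {n y : N} (hy : y ∈ (chartAt F n).source) (hm : ι y ∈ (chartAt E m).source) :
    localTensor (induced (F := F) ι τ) n
      =ᶠ[𝓝 (coord F n y)] pull (localTensor τ m) (localMap E F m ι n) :=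
  eventually_localTensor_eq_pull hι hy hm fun _ _ _ => rfl

omit [FiniteDimensional ℝ E] [FiniteDimensional ℝ F] in
theorem induced_isSmooth (hι : ContMDiff 𝓘(ℝ, F) 𝓘(ℝ, E) ∞ ι) {τ : TwoTensor E M}
    (hτ : IsSmooth τ) : IsSmooth (induced (F := F) ι τ) := by
  intro n y hy
  have hm := mem_chart_source E (ι y)
  refine ContDiffAt.congr_of_eventuallyEq ?_ (localTensor_induced hι τ hy hm)
  refine pull_smooth ?_ (contDiffAt_localMap (hι y) hy hm)
  rw [localMap_coord hy]
  exact hτ _ _ hm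

omit [FiniteDimensional ℝ E] [FiniteDimensional ℝ F] in
theorem riemImmersionAt_localMap (hg : IsRiemannian g) (hs : IsSmooth g)
    (hι : ContMDiff 𝓘(ℝ, F) 𝓘(ℝ, E) ∞ ι)
    (hinj : ∀ y, Function.Injective (dmap (E := E) (F := F) ι y)) {m : M} {n y : N}
    (hy : y ∈ (chartAt F n).source) (hm : ι y ∈ (chartAt E m).source) :
    RiemImmersionAt (localTensor g m) (localMap E F m ι n) (coord F n y) := by
  have hloc : localMap E F m ι n (coord F n y) = coord E m (ι y) := localMap_coord hy
  refine ⟨?_, ?_, contDiffAt_localMap (hι y) hy hm, ?_⟩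
  · rw [hloc]
    exact hs _ _ hm
  · rw [hloc]
    exact hg.eventually_isInner hm
  · intro a b hab
    obtain ⟨u, rfl⟩ := comps_surjective hy a
    obtain ⟨v, rfl⟩ := comps_surjective hy b
    rw [← comps_mfderiv (hι y) hy hm, ← comps_mfderiv (hι y) hy hm] at hab
    rw [hinj y (comps_injective hm hab)]

omit [FiniteDimensional ℝ E] [FiniteDimensional ℝ F] [IsManifold 𝓘(ℝ, E) ∞ M]
  [IsManifold 𝓘(ℝ, F) ∞ N] in
theorem eventually_mem_charts (hι : ContMDiff 𝓘(ℝ, F) 𝓘(ℝ, E) ∞ ι) {m : M} {n y : N}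
    (hy : y ∈ (chartAt F n).source) (hm : ι y ∈ (chartAt E m).source) :
    ∀ᶠ z in 𝓝 (coord F n y), coordInv F n z ∈ (chartAt F n).source ∧
      ι (coordInv F n z) ∈ (chartAt E m).source ∧ coord F n (coordInv F n z) = z := by
  have h1 : ∀ᶠ y' in 𝓝 y, ι y' ∈ (chartAt E m).source :=
    hι.continuous.continuousAt.eventually (eventually_source hm)
  filter_upwards [eventually_coord hy (eventually_source hy), eventually_coord hy h1,
    eventually_coord_eq hy] with z h1 h2 h3
  exact ⟨h1, h2, h3⟩

omit [FiniteDimensional ℝ E] [FiniteDimensional ℝ F] in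
theorem eventually_riemImmersionAt_localMap (hg : IsRiemannian g) (hs : IsSmooth g)
    (hι : ContMDiff 𝓘(ℝ, F) 𝓘(ℝ, E) ∞ ι)
    (hinj : ∀ y, Function.Injective (dmap (E := E) (F := F) ι y)) {m : M} {n y : N}
    (hy : y ∈ (chartAt F n).source) (hm : ι y ∈ (chartAt E m).source) :
    ∀ᶠ z in 𝓝 (coord F n y), RiemImmersionAt (localTensor g m) (localMap E F m ι n) z := by
  filter_upwards [eventually_mem_charts hι hy hm] with z hz
  rw [← hz.2.2]
  exact riemImmersionAt_localMap hg hs hι hinj hz.1 hz.2.1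

omit [FiniteDimensional ℝ E] in
theorem comps_tanPart (hg : IsRiemannian g) (hι : ContMDiff 𝓘(ℝ, F) 𝓘(ℝ, E) ∞ ι)
    (hinj : ∀ y, Function.Injective (dmap (E := E) (F := F) ι y)) {m : M} {n y : N}
    (hy : y ∈ (chartAt F n).source) (hm : ι y ∈ (chartAt E m).source)
    (ξ : TangentSpace 𝓘(ℝ, E) (ι y)) :
    comps n y (tanPart g ι y ξ : TangentSpace 𝓘(ℝ, F) y)
      = tanOp (localTensor g m) (localMap E F m ι n) (coord F n y) (comps m (ι y) ξ) := by
  rw [tanOp, ← (localTensor_induced hι g hy hm).self_of_nhds]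
  refine comps_rieszVec (induced_isRiemannian hg hinj) hy _ fun w => ?_
  rw [← localTensor_coord g hm, dmap, comps_mfderiv (hι y) hy hm, ← localMap_coord (E := E) hy]
  rfl

omit [FiniteDimensional ℝ E] in
theorem comps_norPart (hg : IsRiemannian g) (hι : ContMDiff 𝓘(ℝ, F) 𝓘(ℝ, E) ∞ ι)
    (hinj : ∀ y, Function.Injective (dmap (E := E) (F := F) ι y)) {m : M} {n y : N}
    (hy : y ∈ (chartAt F n).source) (hm : ι y ∈ (chartAt E m).source)
    (ξ : TangentSpace 𝓘(ℝ, E) (ι y)) :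
    comps m (ι y) (norPart F g ι y ξ)
      = norOp (localTensor g m) (localMap E F m ι n) (coord F n y) (comps m (ι y) ξ) := by
  rw [norPart, map_sub, dmap, comps_mfderiv (hι y) hy hm, comps_tanPart hg hι hinj hy hm]
  rfl

theorem comps_norLorentz (hg : IsRiemannian g) (hι : ContMDiff 𝓘(ℝ, F) 𝓘(ℝ, E) ∞ ι)
    (hinj : ∀ y, Function.Injective (dmap (E := E) (F := F) ι y)) {m : M} {n y : N}
    (hy : y ∈ (chartAt F n).source) (hm : ι y ∈ (chartAt E m).source)
    (v : TangentSpace 𝓘(ℝ, F) y) :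
    comps m (ι y) (norLorentz g σ ι y v)
      = norLor (localTensor g m) (localTensor σ m) (localMap E F m ι n) (coord F n y)
        (comps n y v) := by
  rw [norLorentz, comps_norPart hg hι hinj hy hm, comps_lorentz hg hm, dmap,
    comps_mfderiv (hι y) hy hm, norLor, localMap_coord hy]

/-- At `y` the definition extends `w` with constant components in the chart at `y`, so in the fixed
chart `n` the components `W` vary. Their derivative contributes only a tangent vector, which the
normal projection removes: `II` is tensorial, and can then be differentiated as `y` moves. -/
theorem comps_secondFF (hg : IsRiemannian g) (hs : IsSmooth g)
    (hι : ContMDiff 𝓘(ℝ, F) 𝓘(ℝ, E) ∞ ι)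
    (hinj : ∀ y, Function.Injective (dmap (E := E) (F := F) ι y)) {m : M} {n y : N}
    (hy : y ∈ (chartAt F n).source) (hm : ι y ∈ (chartAt E m).source)
    (v w : TangentSpace 𝓘(ℝ, F) y) :
    comps m (ι y) (secondFF g ι y v w)
      = secFF (localTensor g m) (localMap E F m ι n) (coord F n y) (comps n y v)
        (comps n y w) := by
  have hyy := mem_chart_source F y
  have hi := riemImmersionAt_localMap hg hs hι hinj hy hm
  set W : F → F := fun z => fderiv ℝ (localMap F F n (fun y : N => y) y)
    (localMap F F y (fun y : N => y) n z) (comps y y w) with hW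
  have h1 : ContDiffAt ℝ ∞ (localMap F F y (fun y : N => y) n) (coord F n y) :=
    contDiffAt_localMap (f := fun y : N => y) contMDiffAt_id hy hyy
  have h2 : ContDiffAt ℝ ∞ (localMap F F n (fun y : N => y) y) (coord F y y) :=
    contDiffAt_localMap (f := fun y : N => y) contMDiffAt_id hyy hy
  have hloc : localMap F F y (fun y : N => y) n (coord F n y) = coord F y y := localMap_coord hy
  have hWd : DifferentiableAt ℝ W (coord F n y) := by
    have h3 : DifferentiableAt ℝ (fderiv ℝ (localMap F F n (fun y : N => y) y))
        (localMap F F y (fun y : N => y) n (coord F n y)) := by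
      rw [hloc]
      exact (fderiv_smooth h2).differentiableAt (by simp)
    exact (h3.comp (coord F n y) (h1.differentiableAt (by simp))).clm_apply
      (differentiableAt_const _)
  have hWy : W (coord F n y) = comps n y w := by
    simp only [hW]
    rw [hloc, comps_change hyy hy]
  have hev : ∀ᶠ z in 𝓝 (coord F n y), comps m (ι (coordInv F n z))
      (dmap ι (coordInv F n z) (coordField w (coordInv F n z)))
      = fderiv ℝ (localMap E F m ι n) z (W z) := by
    filter_upwards [eventually_mem_charts hι hy hm, eventually_coord hy (eventually_source hyy)]
      with z hz hz'
    rw [dmap, comps_mfderiv (hι _) hz.1 hz.2.1, hz.2.2, ← comps_change hz' hz.1,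
      comps_coordField hz']
    rfl
  rw [secondFF, comps_norPart hg hι hinj hy hm, comps_covAlong hg hs hι hy hm hev
    (((fderiv_smooth hi.smooth).differentiableAt (by simp)).clm_apply hWd),
    hi.cov_tangent hWd, map_add, hi.nor_fderiv, zero_add, hWy]
  -- `secFF` is already normal, so the second normal projection has no effect.
  rw [secFF, norOp, sub_apply]
  change _ - fderiv ℝ _ _ (tanOp _ _ _ (norOp _ _ _ _)) = _
  rw [hi.tan_nor, map_zero, sub_zero]
  rfl

end Extrinsic

/-! ### The two components of the magnetic curvature operator on vector spaces. -/

section MagneticModel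

variable {E : Type*} [NormedAddCommGroup E] [NormedSpace ℝ E]
  {F : Type*} [NormedAddCommGroup F] [NormedSpace ℝ F]

/-- The shape operator of an immersion. -/
def shp (G : E → E →L[ℝ] E →L[ℝ] ℝ) (f : F → E) (z u : F) : E →L[ℝ] F :=
  (pull G f z).inverse ∘L (((norOp G f z ∘L (fderiv ℝ (fderiv ℝ f) z u
    + christ G (f z) (fderiv ℝ f z u) ∘L fderiv ℝ f z)).precomp ℝ) ∘L (G (f z)).flip)

/-- The projection onto a line. -/
def lineOp (G : E → E →L[ℝ] E →L[ℝ] ℝ) (p v : E) : E →L[ℝ] E :=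
  ((G p v v)⁻¹ • G p v).smulRight v

/-- The projection onto a hyperplane. -/
def hyperOp (G : E → E →L[ℝ] E →L[ℝ] ℝ) (p v : E) : E →L[ℝ] E :=
  ContinuousLinearMap.id ℝ E - lineOp G p v

theorem lineOp_apply (G : E → E →L[ℝ] E →L[ℝ] ℝ) (p v z : E) :
    lineOp G p v z = (G p v z / G p v v) • v := by
  simp [lineOp, div_eq_inv_mul]

theorem hyperOp_apply (G : E → E →L[ℝ] E →L[ℝ] ℝ) (p v z : E) :
    hyperOp G p v z = z - lineOp G p v z := rfl

/-- The magnetic curvature operator of a metric and a 2-form on a vector space. -/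
def magModel (G σ : E → E →L[ℝ] E →L[ℝ] ℝ) (s : ℝ) (p v w : E) : E :=
  s ^ 2 • riem G p w v v - s • nabLor G σ p w v + (s / 2) • hyperOp G p v (nabLor G σ p v w)
    + (-((3 / 4 : ℝ) • lor G σ p (lineOp G p v (lor G σ p w)))
      - (1 / 4 : ℝ) • hyperOp G p v (lor G σ p (lor G σ p w)))

/-- Serves, through `magModel_congr`, to replace the coordinate expression of the induced metric by
the pullback of the ambient one. -/
theorem riem_congr {G H : E → E →L[ℝ] E →L[ℝ] ℝ} {p : E} (h : G =ᶠ[𝓝 p] H) :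
    riem G p = riem H p := by
  have h1 : christ G =ᶠ[𝓝 p] christ H := h.eventuallyEq_nhds.mono fun y hy => christ_congr hy
  ext a b c
  have h2 (b : E) : (fun y => christ G y b c) =ᶠ[𝓝 p] fun y => christ H y b c :=
    h1.mono fun y hy => by simp only [hy]
  rw [riem, riem, (h2 a).fderiv_eq, (h2 b).fderiv_eq, h1.self_of_nhds]

theorem nabLor_congr {G H σ τ : E → E →L[ℝ] E →L[ℝ] ℝ} {p : E} (h : G =ᶠ[𝓝 p] H)
    (h' : σ =ᶠ[𝓝 p] τ) : nabLor G σ p = nabLor H τ p := by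
  have h1 : lor G σ =ᶠ[𝓝 p] lor H τ := by
    filter_upwards [h, h'] with y hy hy'
    rw [lor, lor, hy, hy']
  ext a b
  have h2 : (fun y => lor G σ y b) =ᶠ[𝓝 p] fun y => lor H τ y b :=
    h1.mono fun y hy => by simp only [hy]
  rw [nabLor, nabLor, h2.fderiv_eq, h1.self_of_nhds, christ_congr h]

theorem magModel_congr {G H σ τ : E → E →L[ℝ] E →L[ℝ] ℝ} {p : E} (h : G =ᶠ[𝓝 p] H)
    (h' : σ =ᶠ[𝓝 p] τ) (s : ℝ) (v w : E) : magModel G σ s p v w = magModel H τ s p v w := by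
  have h1 : lor G σ p = lor H τ p := by rw [lor, lor, h.self_of_nhds, h'.self_of_nhds]
  simp only [magModel, riem_congr h, nabLor_congr h h', h1, hyperOp, lineOp, h.self_of_nhds]

variable {G σ : E → E →L[ℝ] E →L[ℝ] ℝ} {f : F → E} {z : F}

theorem norOp_lineOp [FiniteDimensional ℝ F] (h : RiemImmersionAt G f z) (v : F) (ξ : E) :
    norOp G f z (lineOp G (f z) (fderiv ℝ f z v) ξ) = 0 := by
  rw [lineOp_apply, map_smul, h.nor_fderiv, smul_zero]

variable [FiniteDimensional ℝ F]

/-- A tangent `v` pairs only with the tangential part of `ξ`, so the ambient projection onto its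
line is the intrinsic one. -/
theorem lineOp_fderiv (h : RiemImmersionAt G f z) (v : F) (ξ : E) :
    lineOp G (f z) (fderiv ℝ f z v) ξ = fderiv ℝ f z (lineOp (pull G f) z v (tanOp G f z ξ)) := by
  rw [lineOp_apply, lineOp_apply, map_smul, h.pull_inner.1 v, h.pull_tan,
    h.inner.self_of_nhds.1 _ ξ, pull_apply]

theorem tan_hyperOp (h : RiemImmersionAt G f z) (v : F) (ξ : E) :
    tanOp G f z (hyperOp G (f z) (fderiv ℝ f z v) ξ)
      = hyperOp (pull G f) z v (tanOp G f z ξ) := by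
  rw [hyperOp_apply, map_sub, lineOp_fderiv h, h.tan_fderiv, hyperOp_apply]

theorem nor_hyperOp (h : RiemImmersionAt G f z) (v : F) (ξ : E) :
    norOp G f z (hyperOp G (f z) (fderiv ℝ f z v) ξ) = norOp G f z ξ := by
  rw [hyperOp_apply, map_sub, norOp_lineOp h, sub_zero]

theorem nor_nor (h : RiemImmersionAt G f z) (ξ : E) :
    norOp G f z (norOp G f z ξ) = norOp G f z ξ := by
  have := congrArg (norOp G f z) (tan_add_nor G f z ξ)
  rw [map_add, h.nor_fderiv, zero_add] at this
  exact this.symm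

theorem tan_secFF (h : RiemImmersionAt G f z) (a b : F) : tanOp G f z (secFF G f z a b) = 0 :=
  h.tan_nor _

theorem nor_secFF (h : RiemImmersionAt G f z) (a b : F) :
    norOp G f z (secFF G f z a b) = secFF G f z a b :=
  nor_nor h _

theorem tan_norLor (h : RiemImmersionAt G f z) (b : F) : tanOp G f z (norLor G σ f z b) = 0 :=
  h.tan_nor _

theorem nor_norLor (h : RiemImmersionAt G f z) (b : F) :
    norOp G f z (norLor G σ f z b) = norLor G σ f z b :=
  nor_nor h _

variable [FiniteDimensional ℝ E]

theorem lor_fderiv (h : RiemImmersionAt G f z) (b : F) :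
    lor G σ (f z) (fderiv ℝ f z b)
      = fderiv ℝ f z (lor (pull G f) (pull σ f) z b) + norLor G σ f z b := by
  rw [h.lor_pull, norLor, ← tan_add_nor]

theorem tan_cov_normal (h : ∀ᶠ y in 𝓝 z, RiemImmersionAt G f y) {ξ : F → E}
    (hξ : DifferentiableAt ℝ ξ z) (hn : ∀ᶠ y in 𝓝 z, tanOp G f y (ξ y) = 0) (u : F) :
    tanOp G f z (cov G f ξ z u) = - shp G f z u (ξ z) := by
  have hz := h.self_of_nhds
  refine hz.pull_inner.eq_of_forall fun c => ?_
  rw [hz.pull_tan, weingarten h hξ hn, map_neg, neg_apply, shp, ContinuousLinearMap.comp_apply,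
    hz.pull_inner.apply_inverse]
  rfl

theorem tan_cov_secFF (h : ∀ᶠ y in 𝓝 z, RiemImmersionAt G f y) (u a b : F) :
    tanOp G f z (cov G f (fun y => secFF G f y a b) z u) = - shp G f z u (secFF G f z a b) :=
  tan_cov_normal h ((h.self_of_nhds.smooth_secFF a b).differentiableAt (by simp))
    (h.mono fun _ hy => tan_secFF hy a b) u

theorem tan_cov_norLor (h : ∀ᶠ y in 𝓝 z, RiemImmersionAt G f y)
    (hσ : ContDiffAt ℝ ∞ σ (f z)) (u a : F) :
    tanOp G f z (cov G f (fun y => norLor G σ f y a) z u) = - shp G f z u (norLor G σ f z a) :=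
  tan_cov_normal h ((smooth_norLor h.self_of_nhds hσ a).differentiableAt (by simp))
    (h.mono fun _ hy => tan_norLor hy a) u

/-- The curvature and `∇_w Y` terms together give both magnetic shape expressions. The correction
inside the hyperplane projection comes from the tangential parts of `∇_v Y` and `Y²`; the term `Y
P_v Y` gives none, because `P_v` takes tangent values. -/
theorem tan_magModel (h : ∀ᶠ y in 𝓝 z, RiemImmersionAt G f y) (hσ : ContDiffAt ℝ ∞ σ (f z))
    (s : ℝ) (v w : F) :
    tanOp G f z (magModel G σ s (f z) (fderiv ℝ f z v) (fderiv ℝ f z w))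
      = magModel (pull G f) (pull σ f) s z v w
        - shp G f z w (s ^ 2 • secFF G f z v v - s • norLor G σ f z v)
        + (s ^ 2 • shp G f z v (secFF G f z v w)
          + s • tanOp G f z (lor G σ (f z) (secFF G f z v w)))
        - (1 / 2 : ℝ) • hyperOp (pull G f) z v (s • shp G f z v (norLor G σ f z w)
            + s • tanOp G f z (lor G σ (f z) (secFF G f z v w))
            + (1 / 2 : ℝ) • tanOp G f z (lor G σ (f z) (norLor G σ f z w))) := by
  have hz := h.self_of_nhds
  have hn (a b : F) : tanOp G f z (nabLor G σ (f z) (fderiv ℝ f z a) (fderiv ℝ f z b))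
      = nabLor (pull G f) (pull σ f) z a b - shp G f z a (norLor G σ f z b)
        - tanOp G f z (lor G σ (f z) (secFF G f z a b)) := by
    rw [nabLor_immersion h hσ, map_sub, map_add, map_add, map_sub, hz.tan_fderiv, tan_norLor hz,
      tan_secFF hz, tan_cov_norLor h hσ]
    abel
  have hr : tanOp G f z (riem G (f z) (fderiv ℝ f z w) (fderiv ℝ f z v) (fderiv ℝ f z v))
      = riem (pull G f) z w v v - shp G f z w (secFF G f z v v)
        + shp G f z v (secFF G f z v w) := by
    rw [gauss_codazzi h, map_add, map_add, map_sub, map_sub, hz.tan_fderiv, tan_secFF hz,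
      tan_secFF hz, tan_cov_secFF h, tan_cov_secFF h, hz.secFF_symm w v]
    abel
  have hl : tanOp G f z (lor G σ (f z) (lor G σ (f z) (fderiv ℝ f z w)))
      = lor (pull G f) (pull σ f) z (lor (pull G f) (pull σ f) z w)
        + tanOp G f z (lor G σ (f z) (norLor G σ f z w)) := by
    rw [lor_fderiv hz w, map_add, map_add, ← hz.lor_pull]
  have hp : tanOp G f z (lor G σ (f z) (lineOp G (f z) (fderiv ℝ f z v)
        (lor G σ (f z) (fderiv ℝ f z w))))
      = lor (pull G f) (pull σ f) z (lineOp (pull G f) z v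
        (lor (pull G f) (pull σ f) z w)) := by
    rw [lineOp_fderiv hz, ← hz.lor_pull, ← hz.lor_pull]
  simp only [magModel, map_add, map_sub, map_neg, map_smul, hn, hr, tan_hyperOp hz, hl, hp,
    hz.secFF_symm w v]
  module

/-- The Codazzi part and `-s ∇_w Y` supply the derivative of the magnetic second fundamental form
along `w`. Its counterpart along `v` carries `+s ∇^⊥_v Y^⊥`, whereas the operator contains only
`s/2` of it; hence the correction `-(s/2) ∇^⊥_v Y^⊥`. -/
theorem nor_magModel (h : ∀ᶠ y in 𝓝 z, RiemImmersionAt G f y) (hσ : ContDiffAt ℝ ∞ σ (f z))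
    (s : ℝ) (v w : F) :
    norOp G f z (magModel G σ s (f z) (fderiv ℝ f z v) (fderiv ℝ f z w))
      = (s ^ 2 • (norOp G f z (cov G f (fun y => secFF G f y v v) z w)
            - secFF G f z (christ (pull G f) z w v) v - secFF G f z v (christ (pull G f) z w v))
          - s • (norOp G f z (cov G f (fun y => norLor G σ f y v) z w)
            - norLor G σ f z (christ (pull G f) z w v)))
        - (s ^ 2 • (norOp G f z (cov G f (fun y => secFF G f y v w) z v)
            - secFF G f z (christ (pull G f) z v v) w - secFF G f z v (christ (pull G f) z v w))
          - s • (norOp G f z (cov G f (fun y => norLor G σ f y w) z v)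
            - norLor G σ f z (christ (pull G f) z v w)))
        - (s / 2) • (norOp G f z (cov G f (fun y => norLor G σ f y w) z v)
            - norLor G σ f z (christ (pull G f) z v w))
        - s • secFF G f z w (lor (pull G f) (pull σ f) z v)
        + (s / 2) • norOp G f z (lor G σ (f z) (secFF G f z v w))
        + (s / 2) • secFF G f z v (lor (pull G f) (pull σ f) z w)
        - (3 / 4 : ℝ) • norLor G σ f z (lineOp (pull G f) z v (lor (pull G f) (pull σ f) z w))
        - (1 / 4 : ℝ) • norLor G σ f z (lor (pull G f) (pull σ f) z w)
        - (1 / 4 : ℝ) • norOp G f z (lor G σ (f z) (norLor G σ f z w)) := by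
  have hz := h.self_of_nhds
  have hn (a b : F) : norOp G f z (nabLor G σ (f z) (fderiv ℝ f z a) (fderiv ℝ f z b))
      = norOp G f z (cov G f (fun y => norLor G σ f y b) z a)
        - norLor G σ f z (christ (pull G f) z a b)
        + secFF G f z a (lor (pull G f) (pull σ f) z b)
        - norOp G f z (lor G σ (f z) (secFF G f z a b)) := by
    rw [nabLor_immersion h hσ, map_sub, map_add, map_add, map_sub, hz.nor_fderiv, nor_norLor hz,
      nor_secFF hz]
    abel
  -- The symmetry of `II` is used under a derivative, hence in a whole neighbourhood.
  have hev : (fun y => secFF G f y w v) =ᶠ[𝓝 z] fun y => secFF G f y v w :=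
    h.mono fun y hy => hy.secFF_symm w v
  have hΓ : christ (pull G f) z w v = christ (pull G f) z v w :=
    christ_symm ((pull_smooth hz.metric_smooth hz.smooth).differentiableAt (by simp))
      (h.mono fun _ hy => hy.pull_inner) w v
  have hr : norOp G f z (riem G (f z) (fderiv ℝ f z w) (fderiv ℝ f z v) (fderiv ℝ f z v))
      = secFF G f z w (christ (pull G f) z v v) - secFF G f z v (christ (pull G f) z w v)
        + (norOp G f z (cov G f (fun y => secFF G f y v v) z w)
          - norOp G f z (cov G f (fun y => secFF G f y v w) z v)) := by
    rw [gauss_codazzi h, map_add, map_add, map_sub, map_sub, hz.nor_fderiv, nor_secFF hz,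
      nor_secFF hz, cov_congr hev]
    abel
  have hl : norOp G f z (lor G σ (f z) (lor G σ (f z) (fderiv ℝ f z w)))
      = norLor G σ f z (lor (pull G f) (pull σ f) z w)
        + norOp G f z (lor G σ (f z) (norLor G σ f z w)) := by
    rw [lor_fderiv hz w, map_add, map_add, norLor.eq_1 G σ f z (lor (pull G f) (pull σ f) z w)]
  have hp : norOp G f z (lor G σ (f z) (lineOp G (f z) (fderiv ℝ f z v)
        (lor G σ (f z) (fderiv ℝ f z w))))
      = norLor G σ f z (lineOp (pull G f) z v (lor (pull G f) (pull σ f) z w)) := by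
    rw [lineOp_fderiv hz, ← hz.lor_pull, norLor]
  simp only [magModel, map_add, map_sub, map_neg, map_smul, hn, hr, nor_hyperOp hz, hl, hp,
    hz.secFF_symm w v, hΓ, hz.secFF_symm (christ (pull G f) z v w) v,
    hz.secFF_symm w (christ (pull G f) z v v)]
  module

end MagneticModel

/-! ### Coordinate form of the magnetic and normal operators, and injectivity of the differential.
-/

section Main

variable {E : Type*} [NormedAddCommGroup E] [NormedSpace ℝ E] [FiniteDimensional ℝ E]
  {M : Type*} [TopologicalSpace M] [ChartedSpace E M] [IsManifold 𝓘(ℝ, E) ∞ M]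
  {F : Type*} [NormedAddCommGroup F] [NormedSpace ℝ F] [FiniteDimensional ℝ F]
  {N : Type*} [TopologicalSpace N] [ChartedSpace F N] [IsManifold 𝓘(ℝ, F) ∞ N]
  {g σ : TwoTensor E M} {ι : N → M}

theorem comps_magCurv (hg : IsRiemannian g) (hs : IsSmooth g) (hσ : IsSmooth σ) (s : ℝ) (x : M)
    (v w : TangentSpace 𝓘(ℝ, E) x) :
    comps x x (magCurv g σ s x v w)
      = magModel (localTensor g x) (localTensor σ x) s (coord E x x) (comps x x v)
        (comps x x w) := by
  have hx := mem_chart_source E x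
  simp only [magCurv, opR, opA, projHyper, map_add, map_sub, map_neg, map_smul,
    comps_curvature hg hs, comps_nablaLorentz hg hs hσ, comps_projLine hx, comps_lorentz hg hx,
    magModel, hyperOp_apply, lineOp_apply]

theorem comps_shapeOp (hg : IsRiemannian g) (hs : IsSmooth g)
    (hι : ContMDiff 𝓘(ℝ, F) 𝓘(ℝ, E) ∞ ι)
    (hinj : ∀ y, Function.Injective (dmap (E := E) (F := F) ι y)) {m : M} {n y : N}
    (hy : y ∈ (chartAt F n).source) (hm : ι y ∈ (chartAt E m).source)
    (ξ : TangentSpace 𝓘(ℝ, E) (ι y)) (v : TangentSpace 𝓘(ℝ, F) y) :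
    comps n y (shapeOp g ι y ξ v)
      = shp (localTensor g m) (localMap E F m ι n) (coord F n y) (comps n y v)
        (comps m (ι y) ξ) := by
  rw [shp, ← (localTensor_induced hι g hy hm).self_of_nhds]
  refine comps_rieszVec (induced_isRiemannian hg hinj) hy _ fun w => ?_
  rw [← localTensor_coord g hm, comps_secondFF hg hs hι hinj hy hm, ← localMap_coord (E := E) hy]
  rfl

theorem comps_norConn (hg : IsRiemannian g) (hs : IsSmooth g)
    (hι : ContMDiff 𝓘(ℝ, F) 𝓘(ℝ, E) ∞ ι)
    (hinj : ∀ y, Function.Injective (dmap (E := E) (F := F) ι y)) {m : M} {n y : N}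
    (hy : y ∈ (chartAt F n).source) (hm : ι y ∈ (chartAt E m).source)
    {ξ : ∀ b : N, TangentSpace 𝓘(ℝ, E) (ι b)} {ξ' : F → E}
    (hξ : ∀ᶠ z in 𝓝 (coord F n y), comps m (ι (coordInv F n z)) (ξ (coordInv F n z)) = ξ' z)
    (hd : DifferentiableAt ℝ ξ' (coord F n y)) (u : TangentSpace 𝓘(ℝ, F) y) :
    comps m (ι y) (norConn g ι ξ y u)
      = norOp (localTensor g m) (localMap E F m ι n) (coord F n y)
        (cov (localTensor g m) (localMap E F m ι n) ξ' (coord F n y) (comps n y u)) := by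
  rw [norConn, comps_norPart hg hι hinj hy hm, comps_covAlong hg hs hι hy hm hξ hd]

/-- Here the chart of `N` is the one at `x`: the fields extending `v` and `w` have constant
components in it, so only the base point of `secFF` is differentiated. -/
theorem comps_norNablaSecondFF (hg : IsRiemannian g) (hs : IsSmooth g)
    (hι : ContMDiff 𝓘(ℝ, F) 𝓘(ℝ, E) ∞ ι)
    (hinj : ∀ y, Function.Injective (dmap (E := E) (F := F) ι y)) {m : M} {x : N}
    (hm : ι x ∈ (chartAt E m).source) (z v w : TangentSpace 𝓘(ℝ, F) x) :
    comps m (ι x) (norNablaSecondFF g ι x z v w)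
      = norOp (localTensor g m) (localMap E F m ι x) (coord F x x)
          (cov (localTensor g m) (localMap E F m ι x)
            (fun y => secFF (localTensor g m) (localMap E F m ι x) y (comps x x v) (comps x x w))
            (coord F x x) (comps x x z))
        - secFF (localTensor g m) (localMap E F m ι x) (coord F x x)
          (christ (pull (localTensor g m) (localMap E F m ι x)) (coord F x x) (comps x x z)
            (comps x x v)) (comps x x w)
        - secFF (localTensor g m) (localMap E F m ι x) (coord F x x) (comps x x v)
          (christ (pull (localTensor g m) (localMap E F m ι x)) (coord F x x) (comps x x z)
            (comps x x w)) := by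
  have hx := mem_chart_source F x
  have hi := induced_isRiemannian hg hinj
  have hev : ∀ᶠ z in 𝓝 (coord F x x), comps m (ι (coordInv F x z))
      (secondFF g ι (coordInv F x z) (coordField v (coordInv F x z))
        (coordField w (coordInv F x z)))
      = secFF (localTensor g m) (localMap E F m ι x) z (comps x x v) (comps x x w) := by
    filter_upwards [eventually_mem_charts hι hx hm] with z hz
    rw [comps_secondFF hg hs hι hinj hz.1 hz.2.1, comps_coordField hz.1, comps_coordField hz.1,
      hz.2.2]
  rw [norNablaSecondFF, map_sub, map_sub, comps_norConn hg hs hι hinj hx hm hev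
    (((riemImmersionAt_localMap hg hs hι hinj hx hm).smooth_secFF _ _).differentiableAt (by simp)),
    comps_secondFF hg hs hι hinj hx hm, comps_secondFF hg hs hι hinj hx hm,
    comps_leviCivita_coordField hi (induced_isSmooth hι hs) hx,
    comps_leviCivita_coordField hi (induced_isSmooth hι hs) hx,
    christ_congr (localTensor_induced hι g hx hm)]

theorem comps_norNablaLorentz (hg : IsRiemannian g) (hs : IsSmooth g) (hσ : IsSmooth σ)
    (hι : ContMDiff 𝓘(ℝ, F) 𝓘(ℝ, E) ∞ ι)
    (hinj : ∀ y, Function.Injective (dmap (E := E) (F := F) ι y)) {m : M} {x : N}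
    (hm : ι x ∈ (chartAt E m).source) (z w : TangentSpace 𝓘(ℝ, F) x) :
    comps m (ι x) (norNablaLorentz g σ ι x z w)
      = norOp (localTensor g m) (localMap E F m ι x) (coord F x x)
          (cov (localTensor g m) (localMap E F m ι x)
            (fun y => norLor (localTensor g m) (localTensor σ m) (localMap E F m ι x) y
              (comps x x w)) (coord F x x) (comps x x z))
        - norLor (localTensor g m) (localTensor σ m) (localMap E F m ι x) (coord F x x)
          (christ (pull (localTensor g m) (localMap E F m ι x)) (coord F x x) (comps x x z)
            (comps x x w)) := by
  have hx := mem_chart_source F x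
  have hi := induced_isRiemannian hg hinj
  have hev : ∀ᶠ z in 𝓝 (coord F x x), comps m (ι (coordInv F x z))
      (norLorentz g σ ι (coordInv F x z) (coordField w (coordInv F x z)))
      = norLor (localTensor g m) (localTensor σ m) (localMap E F m ι x) z (comps x x w) := by
    filter_upwards [eventually_mem_charts hι hx hm] with z hz
    rw [comps_norLorentz hg hι hinj hz.1 hz.2.1, comps_coordField hz.1, hz.2.2]
  rw [norNablaLorentz, map_sub, comps_norConn hg hs hι hinj hx hm hev
    ((smooth_norLor (riemImmersionAt_localMap hg hs hι hinj hx hm)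
      (by rw [localMap_coord hx]; exact hσ _ _ hm) _).differentiableAt (by simp)),
    comps_norLorentz hg hι hinj hx hm,
    comps_leviCivita_coordField hi (induced_isSmooth hι hs) hx,
    christ_congr (localTensor_induced hι g hx hm)]

omit [FiniteDimensional ℝ E] [FiniteDimensional ℝ F] in
theorem comps_projHyper (τ : TwoTensor E M) {m y : M} (hy : y ∈ (chartAt E m).source)
    (v w : TangentSpace 𝓘(ℝ, E) y) :
    comps m y (projHyper τ y v w)
      = hyperOp (localTensor τ m) (coord E m y) (comps m y v) (comps m y w) := by
  rw [projHyper, map_sub, comps_projLine hy, hyperOp_apply, lineOp_apply]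

-- In immersion charts `ι` is the inclusion of a factor. Projecting back onto that factor gives a
-- local left inverse `r`, differentiable at `ι y`, and the chain rule makes its derivative a left
-- inverse of `dι`.
omit [IsManifold 𝓘(ℝ, E) ∞ M] [FiniteDimensional ℝ E] [IsManifold 𝓘(ℝ, F) ∞ N]
  [FiniteDimensional ℝ F] in
theorem dmap_injective (hι : Manifold.IsImmersion 𝓘(ℝ, F) 𝓘(ℝ, E) ∞ ι) (y : N) :
    Function.Injective (dmap (E := E) (F := F) ι y) := by
  have h := hι.isImmersionAt y
  let r : M → N := fun p => h.domChart.symm (h.equiv.symm (h.codChart p)).1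
  have hr : ∀ z ∈ h.domChart.source, r (ι z) = z := by
    intro z hz
    have hw := h.writtenInCharts (show h.domChart z ∈ (h.domChart.extend 𝓘(ℝ, F)).target by
      simpa using h.domChart.map_source hz)
    simp only [Function.comp_apply, OpenPartialHomeomorph.extend_coe,
      OpenPartialHomeomorph.extend_coe_symm, modelWithCornersSelf_coe,
      modelWithCornersSelf_coe_symm, id_eq, h.domChart.left_inv hz] at hw
    simp only [r, hw, ContinuousLinearEquiv.symm_apply_apply, h.domChart.left_inv hz]
  have hv : (h.equiv.symm (h.codChart (ι y))).1 = h.domChart y := by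
    have hw := h.writtenInCharts (show h.domChart y ∈ (h.domChart.extend 𝓘(ℝ, F)).target by
      simpa using h.domChart.map_source h.mem_domChart_source)
    simp only [Function.comp_apply, OpenPartialHomeomorph.extend_coe,
      OpenPartialHomeomorph.extend_coe_symm, modelWithCornersSelf_coe,
      modelWithCornersSelf_coe_symm, id_eq, h.domChart.left_inv h.mem_domChart_source] at hw
    simp only [hw, ContinuousLinearEquiv.symm_apply_apply]
  have hfst : ContMDiff 𝓘(ℝ, E) 𝓘(ℝ, F) ∞ fun e : E => (h.equiv.symm e).1 :=
    ((ContinuousLinearMap.fst ℝ F h.complement).comp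
      (h.equiv.symm : E →L[ℝ] F × h.complement)).contDiff.contMDiff
  have hsymm : ContMDiffAt 𝓘(ℝ, F) 𝓘(ℝ, F) ∞ h.domChart.symm
      (h.equiv.symm (h.codChart (ι y))).1 := by
    rw [hv]
    exact contMDiffAt_symm_of_mem_maximalAtlas h.domChart_mem_maximalAtlas
      (h.domChart.map_source h.mem_domChart_source)
  have hcod : ContMDiffAt 𝓘(ℝ, E) 𝓘(ℝ, E) ∞ h.codChart (ι y) :=
    contMDiffAt_of_mem_maximalAtlas h.codChart_mem_maximalAtlas h.mem_codChart_source
  have hrs : MDifferentiableAt 𝓘(ℝ, E) 𝓘(ℝ, F) r (ι y) :=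
    (ContMDiffAt.comp (ι y) (g := h.domChart.symm) (f := fun p => (h.equiv.symm (h.codChart p)).1)
      hsymm ((hfst _).comp (ι y) hcod)).mdifferentiableAt (by simp)
  have hid : (fun z => r (ι z)) =ᶠ[𝓝 y] id := by
    filter_upwards [h.domChart.open_source.mem_nhds h.mem_domChart_source] with z hz
    exact hr z hz
  have hcomp : HasMFDerivAt 𝓘(ℝ, F) 𝓘(ℝ, F) (r ∘ ι) y
      ((mfderiv 𝓘(ℝ, E) 𝓘(ℝ, F) r (ι y)).comp (mfderiv 𝓘(ℝ, F) 𝓘(ℝ, E) ι y)) :=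
    hrs.hasMFDerivAt.comp y
      ((hι.contMDiff y).mdifferentiableAt (by simp)).hasMFDerivAt
  have heq := hasMFDerivAt_unique (hcomp.congr_of_eventuallyEq hid.symm) (hasMFDerivAt_id y)
  intro u u' huu
  have e1 := congrArg (fun L : F →L[ℝ] F => L u) heq
  have e2 := congrArg (fun L : F →L[ℝ] F => L u') heq
  exact e1.symm.trans ((congrArg (mfderiv 𝓘(ℝ, E) 𝓘(ℝ, F) r (ι y)) huu).trans e2)

end Main

end MagneticGeometry

end

/-! ### The theorem, read in the preferred charts at `x` and `ι x`. -/

open MagneticGeometry in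
theorem theoremA
    {E : Type*} [NormedAddCommGroup E] [NormedSpace ℝ E] [FiniteDimensional ℝ E]
    {M : Type*} [TopologicalSpace M] [ChartedSpace E M] [IsManifold 𝓘(ℝ, E) ∞ M]
    {F : Type*} [NormedAddCommGroup F] [NormedSpace ℝ F] [FiniteDimensional ℝ F]
    {N : Type*} [TopologicalSpace N] [ChartedSpace F N] [IsManifold 𝓘(ℝ, F) ∞ N]
    (B : MagneticSystem E M)
    (ι : N → M) (hι : Manifold.IsImmersion 𝓘(ℝ, F) 𝓘(ℝ, E) ∞ ι)
    (s : ℝ) (hs : 0 < s) (x : N) (v w : TangentSpace 𝓘(ℝ, F) x)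
    (hv : induced ι B.g x v v = 1) (hvw : induced ι B.g x v w = 0) :
    tanPart B.g ι x (magCurv B.g B.form s (ι x) (dmap ι x v) (dmap ι x w))
      = magCurv (induced ι B.g) (induced ι B.form) s x v w
        - shapeOp B.g ι x (magSecondFF B.g B.form ι s x v v) w
        + magShapeOp B.g B.form ι s x v (secondFF B.g ι x v w)
        - (1 / 2 : ℝ) • projHyper (induced ι B.g) x v
            (s • shapeOp B.g ι x (norLorentz B.g B.form ι x w) v
              + s • tanPart B.g ι x (lorentz B.g B.form (ι x) (secondFF B.g ι x v w))
              + (1 / 2 : ℝ) • tanPart B.g ι x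
                  (lorentz B.g B.form (ι x) (norLorentz B.g B.form ι x w)))
    ∧
    norPart F B.g ι x (magCurv B.g B.form s (ι x) (dmap ι x v) (dmap ι x w))
      = norNablaMagSecondFF B.g B.form ι s x w v v
        - norNablaMagSecondFF B.g B.form ι s x v v w
        - (s / 2) • norNablaLorentz B.g B.form ι x v w
        - s • secondFF B.g ι x w (lorentz (induced ι B.g) (induced ι B.form) x v)
        + (s / 2) • norPart F B.g ι x (lorentz B.g B.form (ι x) (secondFF B.g ι x v w))
        + (s / 2) • secondFF B.g ι x v (lorentz (induced ι B.g) (induced ι B.form) x w)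
        - (3 / 4 : ℝ) • norLorentz B.g B.form ι x
            (projLine (induced ι B.g) x v (lorentz (induced ι B.g) (induced ι B.form) x w))
        - (1 / 4 : ℝ) • norLorentz B.g B.form ι x
            (lorentz (induced ι B.g) (induced ι B.form) x w)
        - (1 / 4 : ℝ) • norPart F B.g ι x
            (lorentz B.g B.form (ι x) (norLorentz B.g B.form ι x w)) := by
  have hg : IsRiemannian B.g := ⟨B.metric.symm, B.metric.pos⟩
  have hgs : IsSmooth B.g := isSmooth_of_contMDiff B.metric.contMDiff
  have hσ : IsSmooth B.form := isSmooth_of_contMDiff B.form_smooth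
  have hinj := dmap_injective hι
  have hc := hι.contMDiff
  have hx := mem_chart_source F x
  have hm := mem_chart_source E (ι x)
  have hi := induced_isRiemannian hg hinj
  have hLg := localTensor_induced hc B.g hx hm
  have hLσ := localTensor_induced hc B.form hx hm
  have hloc : localMap E F (ι x) ι x (coord F x x) = coord E (ι x) (ι x) := localMap_coord hx
  have hI := eventually_riemImmersionAt_localMap hg hgs hc hinj hx hm
  have hσ' : ContDiffAt ℝ ∞ (localTensor B.form (ι x)) (localMap E F (ι x) ι x (coord F x x)) := by
    rw [hloc]
    exact hσ _ _ hm
  have hd (u : TangentSpace 𝓘(ℝ, F) x) : comps (ι x) (ι x) (dmap ι x u)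
      = fderiv ℝ (localMap E F (ι x) ι x) (coord F x x) (comps x x u) :=
    comps_mfderiv (hc x) hx hm u
  have hlor (u : TangentSpace 𝓘(ℝ, F) x) :
      comps x x (lorentz (induced ι B.g) (induced ι B.form) x u)
        = lor (pull (localTensor B.g (ι x)) (localMap E F (ι x) ι x))
          (pull (localTensor B.form (ι x)) (localMap E F (ι x) ι x)) (coord F x x)
          (comps x x u) := by
    rw [comps_lorentz hi hx, lor, lor, hLg.self_of_nhds, hLσ.self_of_nhds]
  have hh : hyperOp (localTensor (induced ι B.g) x) (coord F x x)
      = hyperOp (pull (localTensor B.g (ι x)) (localMap E F (ι x) ι x)) (coord F x x) := by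
    ext a b
    simp only [hyperOp_apply, lineOp_apply, hLg.self_of_nhds]
  constructor
  -- Tangential vectors are compared in the chart of `N`, normal ones below in the chart of `M`.
  · apply comps_injective hx
    rw [comps_tanPart hg hc hinj hx hm, comps_magCurv hg hgs hσ, hd, hd, ← hloc,
      tan_magModel hI hσ', ← magModel_congr hLg hLσ]
    simp only [magSecondFF, magShapeOp, map_add, map_sub, map_smul,
      comps_magCurv hi (induced_isSmooth hc hgs) (induced_isSmooth hc hσ),
      comps_shapeOp hg hgs hc hinj hx hm, comps_tanPart hg hc hinj hx hm,
      comps_secondFF hg hgs hc hinj hx hm, comps_norLorentz hg hc hinj hx hm,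
      comps_lorentz hg hm, comps_projHyper _ hx, hh, hloc]
  · apply comps_injective hm
    rw [comps_norPart hg hc hinj hx hm, comps_magCurv hg hgs hσ, hd, hd, ← hloc,
      nor_magModel hI hσ']
    simp only [norNablaMagSecondFF, map_add, map_sub, map_smul,
      comps_norNablaSecondFF hg hgs hc hinj hm, comps_norNablaLorentz hg hgs hσ hc hinj hm,
      comps_norPart hg hc hinj hx hm,
      comps_secondFF hg hgs hc hinj hx hm, comps_norLorentz hg hc hinj hx hm,
      comps_lorentz hg hm, comps_projLine hx, hlor, lineOp_apply, hLg.self_of_nhds, hloc]
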